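/- Banach spaces are over a fixed scalar field $\mathbb K\in\{\mathbb R,\mathbb C\}$; $E'$ is the dual and $B_E$ the closed unit ball of $E$, and $T':F'\to E'$ is the adjoint of a bounded operator $T:E\to F$. A Banach operator ideal $\mathcal A$ assigns to all Banach spaces $E,F$ a linear space $\mathcal A(E;F)$ of bounded operators containing the finite rank operators, with a complete norm $\|\cdot\|_{\mathcal A}$, such that $\|\mathrm{id}_{\mathbb K}\|_{\mathcal A}=1$ and, for $T\in\mathcal A$ and bounded $R,S$ for which the composition is defined, $RTS\in\mathcal A$ and $\|RTS\|_{\mathcal A}\le\|R\|\,\|T\|_{\mathcal A}\|S\|$. Two classes of operators with norms are equal isometrically if they have the same members with the same norms. The dual $\mathcal A^d$ consists of all bounded $T$ with $T'\in\mathcal A$, with $\|T\|_{\mathcal A^d}=\|T'\|_{\mathcal A}$; write $\mathcal A^{dd}=(\mathcal A^d)^d$. The composition $\mathcal A\circ\mathcal B$ consists of all $RS$ with $R\in\mathcal A$, $S\in\mathcal B$, normed by the infimum of $\|R\|_{\mathcal A}\|S\|_{\mathcal B}$ over all such factorizations. Let $\overline{\mathcal F}$ be the ideal of approximable operators (operator-norm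 limits of finite rank operators, with the operator norm). $\mathcal A$ is right-accessible if $\overline{\mathcal F}\circ\mathcal A\circ\overline{\mathcal F}=\mathcal A\circ\overline{\mathcal F}$ isometrically. A set $K\subset E$ is relatively $\mathcal A$-compact if $K\subset T(M)$ for some Banach space $X$, some $T\in\mathcal A(X;E)$ and some compact $M\subset X$; its size $m_{\mathcal A}(K;E)$ is the infimum of $\|T\|_{\mathcal A}$ over all Banach spaces $X$, $T\in\mathcal A(X;E)$ and compact $M\subset B_X$ with $K\subset T(M)$. The class $\mathcal K_{\mathcal A}$ of $\mathcal A$-compact operators consists of all bounded $T:E\to F$ such that $T(B_E)$ is relatively $\mathcal A$-compact, with $\|T\|_{\mathcal K_{\mathcal A}}=m_{\mathcal A}(T(B_E);F)$. **Proposition.** Let $\mathcal A$ be a Banach operator ideal. Then $\mathcal K_{\mathcal A}\subset\mathcal K_{\mathcal A}^{dd}$, and $\|T\|_{\mathcal K_{\mathcal A}^{dd}}\le\|T\|_{\mathcal K_{\mathcal A}}$ for every $T\in\mathcal K_{\mathcal A}$. If moreover $\mathcal A$ is right-accessible, then $\mathcal K_{\mathcal A}=\mathcal K_{\mathcal A}^{dd}$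 isometrically; in particular $\mathcal K_{\mathcal A}$ is a dual operator ideal, that is, $\mathcal K_{\mathcal A}=\mathcal B^d$ isometrically for some Banach operator ideal $\mathcal B$. -/

import Mathlib

open Topology Filter

universe u

noncomputable section

/-- A class of bounded operators between Banach spaces over `𝕜`, together with a real-valued
function on operators. Only the values of `nrm` on members of the class are meaningful. -/
structure OperatorClass (𝕜 : Type) [RCLike 𝕜] where
  Mem : ∀ ⦃E F : Type u⦄ [NormedAddCommGroup E] [NormedSpace 𝕜 E] [CompleteSpace E]
    [NormedAddCommGroup F] [NormedSpace 𝕜 F] [CompleteSpace F], (E →L[𝕜] F) → Prop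
  nrm : ∀ ⦃E F : Type u⦄ [NormedAddCommGroup E] [NormedSpace 𝕜 E] [CompleteSpace E]
    [NormedAddCommGroup F] [NormedSpace 𝕜 F] [CompleteSpace F], (E →L[𝕜] F) → ℝ

namespace OperatorClass

/-- `A` is a Banach operator ideal: every component is a linear space of operators containing the
finite rank operators and complete under the norm `A.nrm`, the ideal property holds with its norm
estimate, and the identity of the scalar field has norm one. -/
structure IsBanachOperatorIdeal {𝕜 : Type} [RCLike 𝕜] (A : OperatorClass.{u} 𝕜) : Prop where
  mem_of_finiteRank : ∀ ⦃E F : Type u⦄ [NormedAddCommGroup E] [NormedSpace 𝕜 E] [CompleteSpace E]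
    [NormedAddCommGroup F] [NormedSpace 𝕜 F] [CompleteSpace F] (T : E →L[𝕜] F),
    FiniteDimensional 𝕜 (LinearMap.range (T : E →ₗ[𝕜] F)) → A.Mem T
  add_mem : ∀ ⦃E F : Type u⦄ [NormedAddCommGroup E] [NormedSpace 𝕜 E] [CompleteSpace E]
    [NormedAddCommGroup F] [NormedSpace 𝕜 F] [CompleteSpace F] (S T : E →L[𝕜] F),
    A.Mem S → A.Mem T → A.Mem (S + T)
  smul_mem : ∀ ⦃E F : Type u⦄ [NormedAddCommGroup E] [NormedSpace 𝕜 E] [CompleteSpace E]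
    [NormedAddCommGroup F] [NormedSpace 𝕜 F] [CompleteSpace F] (c : 𝕜) (T : E →L[𝕜] F),
    A.Mem T → A.Mem (c • T)
  comp_mem : ∀ ⦃D E F G : Type u⦄ [NormedAddCommGroup D] [NormedSpace 𝕜 D] [CompleteSpace D]
    [NormedAddCommGroup E] [NormedSpace 𝕜 E] [CompleteSpace E]
    [NormedAddCommGroup F] [NormedSpace 𝕜 F] [CompleteSpace F]
    [NormedAddCommGroup G] [NormedSpace 𝕜 G] [CompleteSpace G]
    (R : F →L[𝕜] G) (T : E →L[𝕜] F) (S : D →L[𝕜] E),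
    A.Mem T → A.Mem (R ∘L T ∘L S)
  nrm_nonneg : ∀ ⦃E F : Type u⦄ [NormedAddCommGroup E] [NormedSpace 𝕜 E] [CompleteSpace E]
    [NormedAddCommGroup F] [NormedSpace 𝕜 F] [CompleteSpace F] (T : E →L[𝕜] F),
    A.Mem T → 0 ≤ A.nrm T
  eq_zero_of_nrm_eq_zero : ∀ ⦃E F : Type u⦄ [NormedAddCommGroup E] [NormedSpace 𝕜 E]
    [CompleteSpace E] [NormedAddCommGroup F] [NormedSpace 𝕜 F] [CompleteSpace F] (T : E →L[𝕜] F),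
    A.Mem T → A.nrm T = 0 → T = 0
  nrm_add_le : ∀ ⦃E F : Type u⦄ [NormedAddCommGroup E] [NormedSpace 𝕜 E] [CompleteSpace E]
    [NormedAddCommGroup F] [NormedSpace 𝕜 F] [CompleteSpace F] (S T : E →L[𝕜] F),
    A.Mem S → A.Mem T → A.nrm (S + T) ≤ A.nrm S + A.nrm T
  nrm_smul : ∀ ⦃E F : Type u⦄ [NormedAddCommGroup E] [NormedSpace 𝕜 E] [CompleteSpace E]
    [NormedAddCommGroup F] [NormedSpace 𝕜 F] [CompleteSpace F] (c : 𝕜) (T : E →L[𝕜] F),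
    A.Mem T → A.nrm (c • T) = ‖c‖ * A.nrm T
  nrm_comp_le : ∀ ⦃D E F G : Type u⦄ [NormedAddCommGroup D] [NormedSpace 𝕜 D] [CompleteSpace D]
    [NormedAddCommGroup E] [NormedSpace 𝕜 E] [CompleteSpace E]
    [NormedAddCommGroup F] [NormedSpace 𝕜 F] [CompleteSpace F]
    [NormedAddCommGroup G] [NormedSpace 𝕜 G] [CompleteSpace G]
    (R : F →L[𝕜] G) (T : E →L[𝕜] F) (S : D →L[𝕜] E),
    A.Mem T → A.nrm (R ∘L T ∘L S) ≤ ‖R‖ * A.nrm T * ‖S‖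
  /- `ULift 𝕜` is the scalar field, placed in the universe of the Banach spaces. -/
  nrm_id : A.nrm (ContinuousLinearMap.id 𝕜 (ULift.{u} 𝕜)) = 1
  complete : ∀ ⦃E F : Type u⦄ [NormedAddCommGroup E] [NormedSpace 𝕜 E] [CompleteSpace E]
    [NormedAddCommGroup F] [NormedSpace 𝕜 F] [CompleteSpace F] (T : ℕ → E →L[𝕜] F),
    (∀ n, A.Mem (T n)) →
    (∀ ε : ℝ, 0 < ε → ∃ N : ℕ, ∀ m ≥ N, ∀ n ≥ N, A.nrm (T m - T n) < ε) →
    ∃ S : E →L[𝕜] F, A.Mem S ∧ Tendsto (fun n => A.nrm (T n - S)) atTop (𝓝 0)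

/-- `A ⊆ B`, and the norm of `B` is at most the norm of `A` on members of `A`. -/
def ContractivelyIncluded {𝕜 : Type} [RCLike 𝕜] (A B : OperatorClass.{u} 𝕜) : Prop :=
  ∀ ⦃E F : Type u⦄ [NormedAddCommGroup E] [NormedSpace 𝕜 E] [CompleteSpace E]
    [NormedAddCommGroup F] [NormedSpace 𝕜 F] [CompleteSpace F] (T : E →L[𝕜] F),
    A.Mem T → B.Mem T ∧ B.nrm T ≤ A.nrm T

/-- `A = B` isometrically: the same operators, with the same norms. -/
def IsometricallyEqual {𝕜 : Type} [RCLike 𝕜] (A B : OperatorClass.{u} 𝕜) : Prop :=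
  ∀ ⦃E F : Type u⦄ [NormedAddCommGroup E] [NormedSpace 𝕜 E] [CompleteSpace E]
    [NormedAddCommGroup F] [NormedSpace 𝕜 F] [CompleteSpace F] (T : E →L[𝕜] F),
    (A.Mem T ↔ B.Mem T) ∧ (A.Mem T → A.nrm T = B.nrm T)

/-- The adjoint (transpose) `T' : F' → E'`, `T' φ = φ ∘ T`. -/
def adj {𝕜 : Type} [RCLike 𝕜] {E F : Type u} [NormedAddCommGroup E] [NormedSpace 𝕜 E]
    [NormedAddCommGroup F] [NormedSpace 𝕜 F] (T : E →L[𝕜] F) :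
    StrongDual 𝕜 F →L[𝕜] StrongDual 𝕜 E :=
  (ContinuousLinearMap.compL 𝕜 E F 𝕜).flip T

/-- The dual `A^d`: operators whose adjoint lies in `A`, with the norm of the adjoint. -/
def dual {𝕜 : Type} [RCLike 𝕜] (A : OperatorClass.{u} 𝕜) : OperatorClass.{u} 𝕜 where
  Mem _ _ _ _ _ _ _ _ T := A.Mem (adj T)
  nrm _ _ _ _ _ _ _ _ T := A.nrm (adj T)

/-- The composition `A ∘ B`, with norm the infimum of `‖R‖_A ‖S‖_B` over all factorizations
`T = R S` with `R` in `A` and `S` in `B`. -/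
def comp {𝕜 : Type} [RCLike 𝕜] (A B : OperatorClass.{u} 𝕜) : OperatorClass.{u} 𝕜 where
  Mem E F _ _ _ _ _ _ T :=
    ∃ (G : Type u) (_ : NormedAddCommGroup G) (_ : NormedSpace 𝕜 G) (_ : CompleteSpace G)
      (R : G →L[𝕜] F) (S : E →L[𝕜] G), A.Mem R ∧ B.Mem S ∧ T = R ∘L S
  nrm E F _ _ _ _ _ _ T := sInf {r : ℝ |
    ∃ (G : Type u) (_ : NormedAddCommGroup G) (_ : NormedSpace 𝕜 G) (_ : CompleteSpace G)
      (R : G →L[𝕜] F) (S : E →L[𝕜] G), A.Mem R ∧ B.Mem S ∧ T = R ∘L S ∧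
        r = A.nrm R * B.nrm S}

/-- The approximable operators: norm limits of finite rank operators, with the operator norm. -/
def approximable (𝕜 : Type) [RCLike 𝕜] : OperatorClass.{u} 𝕜 where
  Mem E F _ _ _ _ _ _ T := T ∈ closure
    {S : E →L[𝕜] F | FiniteDimensional 𝕜 (LinearMap.range (S : E →ₗ[𝕜] F))}
  nrm _ _ _ _ _ _ _ _ T := ‖T‖

/-- The minimal kernel `A^min`: approximable, composed with `A`, composed with approximable. -/
def minKernel {𝕜 : Type} [RCLike 𝕜] (A : OperatorClass.{u} 𝕜) : OperatorClass.{u} 𝕜 :=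
  ((approximable 𝕜).comp A).comp (approximable 𝕜)

/-- `A` is right-accessible: `A^min = A ∘ (approximable)` isometrically. -/
def RightAccessible {𝕜 : Type} [RCLike 𝕜] (A : OperatorClass.{u} 𝕜) : Prop :=
  A.minKernel.IsometricallyEqual (A.comp (approximable 𝕜))

/-- `K ⊆ E` is relatively `A`-compact: `K ⊆ T(M)` for some `T ∈ A(X; E)` and compact `M ⊆ X`. -/
def RelativelyCompact {𝕜 : Type} [RCLike 𝕜] (A : OperatorClass.{u} 𝕜) {E : Type u}
    [NormedAddCommGroup E] [NormedSpace 𝕜 E] [CompleteSpace E] (K : Set E) : Prop :=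
  ∃ (X : Type u) (_ : NormedAddCommGroup X) (_ : NormedSpace 𝕜 X) (_ : CompleteSpace X)
    (T : X →L[𝕜] E) (M : Set X), A.Mem T ∧ IsCompact M ∧ K ⊆ T '' M

/-- The size `m_A(K; E)`: the infimum of `‖T‖_A` over all `T ∈ A(X; E)` and compact sets `M` in
the closed unit ball of `X` with `K ⊆ T(M)`. -/
def size {𝕜 : Type} [RCLike 𝕜] (A : OperatorClass.{u} 𝕜) {E : Type u}
    [NormedAddCommGroup E] [NormedSpace 𝕜 E] [CompleteSpace E] (K : Set E) : ℝ :=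
  sInf {r : ℝ |
    ∃ (X : Type u) (_ : NormedAddCommGroup X) (_ : NormedSpace 𝕜 X) (_ : CompleteSpace X)
      (T : X →L[𝕜] E) (M : Set X), A.Mem T ∧ IsCompact M ∧ M ⊆ Metric.closedBall 0 1 ∧
        K ⊆ T '' M ∧ r = A.nrm T}

/-- The class `K_A` of `A`-compact operators: those `T` for which the image of the closed unit
ball is relatively `A`-compact, normed by the size of that image. -/
def compactOperators {𝕜 : Type} [RCLike 𝕜] (A : OperatorClass.{u} 𝕜) : OperatorClass.{u} 𝕜 where
  Mem E _ _ _ _ _ _ _ T := A.RelativelyCompact (T '' Metric.closedBall (0 : E) 1)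
  nrm E _ _ _ _ _ _ _ T := A.size (T '' Metric.closedBall (0 : E) 1)

/-- `A` is a dual operator ideal: `A = B^d` isometrically for some Banach operator ideal `B`. -/
def IsDualIdeal {𝕜 : Type} [RCLike 𝕜] (A : OperatorClass.{u} 𝕜) : Prop :=
  ∃ B : OperatorClass.{u} 𝕜, B.IsBanachOperatorIdeal ∧ A.IsometricallyEqual B.dual

end OperatorClass

end

/-! Write `J` for the canonical embedding of a space into its bidual.

Inclusion in the bidual: if `T(B_E) ⊆ R(M)` with `M` compact, then `T''` sends the unit ball of
`E''` into the weak-star closure of `J T(B_E)`. The set `J R(M)` is compact, hence already weak-star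
closed, so `T''(B_{E''}) ⊆ (J R)(M)`, and `J R` has `A`-norm at most that of `R`
(`adj_adj_mem_of_isCompact`, `Covers.adj_adj`). No accessibility is needed.

Converse: let `T''(B_{E''}) ⊆ R(M)` with `R : X → F''` in `A`. On the closed subspace `Z = R⁻¹(J F)`
one has `R = J R₁` with `R₁ : Z → F`, and `T(B_E) ⊆ R₁(M ∩ Z)`. The difficulty is that `J R₁ ∈ A`
does not give `R₁ ∈ A`. Right-accessibility repairs this on finite-dimensional domains: there `‖W‖_A
≤ ‖J W‖_A` (`RightAccessible.nrm_le_nrm_inclusion_comp`), because `J W` factors as `P Q` with `P`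
approximable and `‖P‖ ‖Q‖_A` close to `‖J W‖_A`, and local reflexivity pulls the nearly finite rank
`P` back from `F''` into `F`.

To use only finite-dimensional domains, each point of the compact set is written as a series with
terms in fixed finite sets of geometrically decreasing size (`exists_finite_sets_hasSum`). The
restrictions of `R₁` to the spans of these sets are glued over an `ℓ¹`-sum into one operator of `A`
(`covers_of_hasSum`), at the price of a factor `(1 - δ)⁻²`, and `δ → 0` gives the isometric
statement.

For the last claim, `B = K_A^d` works once `K_A` and duals of ideals are known to be Banach operator
ideals; completeness of `K_A` again comes from `covers_of_hasSum`. -/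

set_option maxSynthPendingDepth 3

noncomputable section

variable {𝕜 : Type} [RCLike 𝕜]

namespace RCLike

theorem exists_norm_eq_one_mul_eq_norm (z : 𝕜) : ∃ c : 𝕜, ‖c‖ = 1 ∧ c * z = (‖z‖ : 𝕜) := by
  rcases eq_or_ne z 0 with rfl | hz
  · exact ⟨1, by simp, by simp⟩
  · refine ⟨(‖z‖ : 𝕜) / z, ?_, ?_⟩
    · rw [norm_div, RCLike.norm_ofReal, abs_norm, div_self (norm_ne_zero_iff.mpr hz)]
    · rw [div_mul_cancel₀ _ hz]

end RCLike

/-! ### Norms and values of functionals. -/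

section Functionals

variable {E : Type*} [NormedAddCommGroup E] [NormedSpace 𝕜 E]

theorem StrongDual.norm_le_of_re_le (φ : StrongDual 𝕜 E) {u : ℝ}
    (h : ∀ x, ‖x‖ ≤ 1 → RCLike.re (φ x) ≤ u) : ‖φ‖ ≤ u := by
  have hu : 0 ≤ u := by simpa using h 0 (by simp)
  refine ContinuousLinearMap.opNorm_le_of_unit_norm (𝕜 := 𝕜) hu fun x hx => ?_
  obtain ⟨c, hc, hcz⟩ := RCLike.exists_norm_eq_one_mul_eq_norm (φ x)
  have := h (c • x) (by rw [norm_smul, hc, hx, one_mul])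
  rwa [map_smul, smul_eq_mul, hcz, RCLike.ofReal_re] at this

/-- A functional maps the open ball of radius `r` onto the open disc of radius `r * ‖g‖`; the
alternative `z = 0` covers `g = 0`. -/
theorem StrongDual.exists_norm_lt_apply_eq (g : StrongDual 𝕜 E) {z : 𝕜} {r : ℝ} (hr : 0 < r)
    (hz : ‖z‖ < r * ‖g‖ ∨ z = 0) : ∃ v : E, ‖v‖ < r ∧ g v = z := by
  rcases eq_or_ne z 0 with rfl | hz0
  · exact ⟨0, by simpa using hr, by simp⟩
  replace hz := hz.resolve_right hz0
  have h1 : ‖z‖ / r < ‖g‖ := by rwa [div_lt_iff₀ hr, mul_comm]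
  obtain ⟨x, hx1, hx⟩ := g.exists_lt_apply_of_lt_opNorm h1
  have hgx : 0 < ‖g x‖ := lt_of_le_of_lt (by positivity) hx
  refine ⟨(z / g x) • x, ?_, ?_⟩
  · rw [norm_smul, norm_div]
    calc ‖z‖ / ‖g x‖ * ‖x‖ ≤ ‖z‖ / ‖g x‖ * 1 := by gcongr
      _ < r := by
        rw [mul_one, div_lt_iff₀ hgx, mul_comm]
        rwa [div_lt_iff₀ hr] at hx
  · rw [map_smul, smul_eq_mul, div_mul_cancel₀ _ (norm_pos_iff.mp hgx)]

end Functionals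

/-! ### Adjoints, and second adjoints of compact operators. -/

namespace OperatorClass

section Adjoint

variable {D E F : Type u} [NormedAddCommGroup D] [NormedSpace 𝕜 D]
  [NormedAddCommGroup E] [NormedSpace 𝕜 E] [NormedAddCommGroup F] [NormedSpace 𝕜 F]

@[simp] theorem adj_apply (T : E →L[𝕜] F) (φ : StrongDual 𝕜 F) (x : E) : adj T φ x = φ (T x) := rfl

theorem adj_add (S T : E →L[𝕜] F) : adj (S + T) = adj S + adj T := by
  ext φ x; simp

theorem adj_sub (S T : E →L[𝕜] F) : adj (S - T) = adj S - adj T := by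
  ext φ x; simp

theorem adj_smul (c : 𝕜) (T : E →L[𝕜] F) : adj (c • T) = c • adj T := by
  ext φ x; simp

theorem norm_adj (T : E →L[𝕜] F) : ‖adj T‖ = ‖T‖ := by
  apply le_antisymm
  · refine ContinuousLinearMap.opNorm_le_bound _ (norm_nonneg _) fun φ => ?_
    rw [mul_comm]
    exact ContinuousLinearMap.opNorm_comp_le φ T
  · refine ContinuousLinearMap.opNorm_le_bound _ (norm_nonneg _) fun x => ?_
    obtain ⟨φ, hφ, hx⟩ := exists_dual_vector'' 𝕜 (T x)
    have h : ‖adj T φ x‖ = ‖T x‖ := by rw [adj_apply, hx, RCLike.norm_ofReal, abs_norm]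
    rw [← h]
    calc ‖adj T φ x‖ ≤ ‖adj T φ‖ * ‖x‖ := (adj T φ).le_opNorm x
      _ ≤ ‖adj T‖ * ‖φ‖ * ‖x‖ := by gcongr; exact (adj T).le_opNorm φ
      _ ≤ ‖adj T‖ * 1 * ‖x‖ := by gcongr
      _ = _ := by rw [mul_one]

theorem adj_adj_inclusion (T : E →L[𝕜] F) (x : E) :
    adj (adj T) (NormedSpace.inclusionInDoubleDual 𝕜 E x) =
      NormedSpace.inclusionInDoubleDual 𝕜 F (T x) := rfl

end Adjoint

/-- If `T` maps the unit ball into a compact set, the second adjoint maps the unit ball of the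
bidual into the canonical image of that set. -/
theorem adj_adj_mem_of_isCompact {E F : Type u} [NormedAddCommGroup E] [NormedSpace 𝕜 E]
    [NormedAddCommGroup F] [NormedSpace 𝕜 F] (T : E →L[𝕜] F) {K : Set F} (hK : IsCompact K)
    (hT : T '' Metric.closedBall 0 1 ⊆ K) (ξ : StrongDual 𝕜 (StrongDual 𝕜 E)) (hξ : ‖ξ‖ ≤ 1) :
    ∃ y ∈ K, adj (adj T) ξ = NormedSpace.inclusionInDoubleDual 𝕜 F y := by
  classical
  let _ : NormedSpace ℝ E := NormedSpace.restrictScalars ℝ 𝕜 E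
  let _ : NormedSpace ℝ F := NormedSpace.restrictScalars ℝ 𝕜 F
  have : IsScalarTower ℝ 𝕜 E := RestrictScalars.isScalarTower ℝ 𝕜 E
  have : IsScalarTower ℝ 𝕜 F := RestrictScalars.isScalarTower ℝ 𝕜 F
  set C : Set F := closure (T '' Metric.closedBall 0 1) with hC
  have hCK : C ⊆ K := closure_minimal hT hK.isClosed
  have hCc : IsCompact C := hK.of_isClosed_subset isClosed_closure hCK
  have hconv : Convex ℝ C :=
    ((convex_closedBall (0 : E) 1).linear_image (T.toLinearMap.restrictScalars ℝ)).closure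
  -- Compactness of `C` reduces the problem to finitely many functionals, where a compact convex set
  -- in a finite-dimensional space can be separated from a point.
  have key : (C ∩ ⋂ φ : StrongDual 𝕜 F, {y | φ y = ξ (adj T φ)}).Nonempty := by
    refine hCc.inter_iInter_nonempty _ (fun φ => isClosed_eq φ.continuous continuous_const)
      fun s => ?_
    let Ψ : F →L[𝕜] (s → 𝕜) := ContinuousLinearMap.pi fun φ => (φ : StrongDual 𝕜 F)
    let p : s → 𝕜 := fun φ => ξ (adj T φ)
    have hp : p ∈ Ψ '' C := by
      by_contra hp
      obtain ⟨f, v, h1, h2⟩ := RCLike.geometric_hahn_banach_closed_point (𝕜 := 𝕜)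
        (hconv.linear_image (Ψ.toLinearMap.restrictScalars ℝ))
        (hCc.image Ψ.continuous).isClosed hp
      have hf : ∀ q : s → 𝕜, f q = ∑ φ, f (Pi.single φ 1) * q φ := fun q => by
        conv_lhs => rw [pi_eq_sum_univ' q]
        simp only [map_sum, map_smul, smul_eq_mul]
        refine Finset.sum_congr rfl fun i _ => ?_
        rw [mul_comm]
      have hfp : f p = ξ (adj T (f ∘L Ψ)) := by
        have : f ∘L Ψ = ∑ φ : s, f (Pi.single φ 1) • (φ : StrongDual 𝕜 F) := by
          ext x
          rw [ContinuousLinearMap.comp_apply, hf]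
          simp [Ψ]
        rw [this, hf]
        simp [p]
      -- The separating functional is bounded by `v` on `T(B_E)`, which bounds the norm of its image
      -- under `T'`; since `‖ξ‖ ≤ 1`, `ξ` cannot exceed `v` there.
      have hle : ‖adj T (f ∘L Ψ)‖ ≤ v := StrongDual.norm_le_of_re_le _ fun x hx =>
        (h1 _ ⟨T x, subset_closure ⟨x, by simpa using hx, rfl⟩, rfl⟩).le
      rw [hfp] at h2
      have h3 : RCLike.re (ξ (adj T (f ∘L Ψ))) ≤ v :=
        calc _ ≤ ‖ξ (adj T (f ∘L Ψ))‖ := RCLike.re_le_norm _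
          _ ≤ ‖ξ‖ * ‖adj T (f ∘L Ψ)‖ := ξ.le_opNorm _
          _ ≤ 1 * v := by gcongr
          _ = v := one_mul v
      linarith
    obtain ⟨y, hy, hyp⟩ := hp
    exact ⟨y, hy, Set.mem_iInter₂.2 fun φ hφ => congrFun hyp ⟨φ, hφ⟩⟩
  obtain ⟨y, hy, hy2⟩ := key
  refine ⟨y, hCK hy, ?_⟩
  ext φ
  exact (Set.mem_iInter.1 hy2 φ).symm

end OperatorClass

/-! ### Local reflexivity. -/

section LocalReflexivity

variable {L F : Type*} [NormedAddCommGroup L] [NormedSpace 𝕜 L] [FiniteDimensional 𝕜 L]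
  [NormedAddCommGroup F] [NormedSpace 𝕜 F]

/-- The attainable tuples `(T (w k))` form a subspace. Were it to miss the product of open balls,
Hahn–Banach would give functionals `g k` annihilating it, that is, `∑ w k ⊗ g k = 0`. Pairing this
tensor with `ι` gives `∑ ι (w k) (g k) = 0`, while `h` realises this sum as the value of the
separating functional at a point of the balls, where its real part is negative. -/
theorem exists_clm_forall_mem_ball (ι : L →ₗ[𝕜] StrongDual 𝕜 (StrongDual 𝕜 F))
    {K : Type*} [Fintype K] (w : K → L) (c : K → F) (r : K → ℝ)
    (h : ∀ k, ∀ g : StrongDual 𝕜 F, ∃ v ∈ Metric.ball (c k) (r k), g v = ι (w k) g) :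
    ∃ T : L →L[𝕜] F, ∀ k, T (w k) ∈ Metric.ball (c k) (r k) := by
  classical
  let _ : NormedSpace ℝ F := NormedSpace.restrictScalars ℝ 𝕜 F
  have : IsScalarTower ℝ 𝕜 F := RestrictScalars.isScalarTower ℝ 𝕜 F
  by_contra hcon
  push Not at hcon
  let Θ : (L →L[𝕜] F) →ₗ[𝕜] (K → F) :=
    { toFun := fun T k => T (w k)
      map_add' := fun _ _ => rfl
      map_smul' := fun _ _ => rfl }
  have hdisj : Disjoint (Set.univ.pi fun k => Metric.ball (c k) (r k))
      (LinearMap.range Θ : Set (K → F)) := by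
    rw [Set.disjoint_left]
    rintro _ hs ⟨T, rfl⟩
    obtain ⟨k, hk⟩ := hcon T
    exact hk (hs k trivial)
  obtain ⟨f, u, h1, h2⟩ := RCLike.geometric_hahn_banach_open (𝕜 := 𝕜)
    (convex_pi fun k _ => convex_ball (c k) (r k))
    (isOpen_set_pi Set.finite_univ fun k _ => Metric.isOpen_ball)
    (((LinearMap.range Θ).restrictScalars ℝ).convex) hdisj
  have hu : u ≤ 0 := by simpa using h2 0 (zero_mem (LinearMap.range Θ))
  -- A functional whose real part is bounded below on a subspace vanishes there; the scaling would
  -- make the real part `u - 1`.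
  have hf0 : ∀ T, f (Θ T) = 0 := fun T => by
    by_contra hne
    have := h2 (Θ ((((u - 1 : ℝ) : 𝕜) / f (Θ T)) • T)) ⟨_, rfl⟩
    rw [map_smul, map_smul, smul_eq_mul, div_mul_cancel₀ _ hne, RCLike.ofReal_re] at this
    linarith
  let g : K → StrongDual 𝕜 F := fun k => f ∘L ContinuousLinearMap.single 𝕜 (fun _ : K => F) k
  have hfg : ∀ a : K → F, f a = ∑ k, g k (a k) := fun a => by
    conv_lhs => rw [← Finset.univ_sum_single a, map_sum]
    rfl
  choose v hv hgv using fun k => h k (g k)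
  have hlt := h1 v fun k _ => hv k
  let b := Module.finBasis 𝕜 L
  have hcoord : ∀ j, ∑ k, b.coord j (w k) • g k = 0 := fun j => by
    ext y
    have := hf0 ((LinearMap.toContinuousLinearMap (b.coord j)).smulRight y)
    rw [hfg] at this
    simpa [Θ] using this
  have hzero : f v = 0 := by
    rw [hfg]
    calc ∑ k, g k (v k) = ∑ k, ∑ j, b.coord j (w k) * ι (b j) (g k) := by
          refine Finset.sum_congr rfl fun k _ => ?_
          rw [hgv]
          conv_lhs => rw [← b.sum_repr (w k)]
          simp only [map_sum, map_smul, sum_apply, smul_apply,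
            smul_eq_mul, Module.Basis.coord_apply]
      _ = ∑ j, ι (b j) (∑ k, b.coord j (w k) • g k) := by
          rw [Finset.sum_comm]
          simp only [map_sum, map_smul, smul_eq_mul]
      _ = 0 := by simp only [hcoord, map_zero, Finset.sum_const_zero]
  rw [hzero, map_zero] at hlt
  linarith

/-- Approximate principle of local reflexivity. -/
theorem exists_clm_norm_le_approx (ι : L →L[𝕜] StrongDual 𝕜 (StrongDual 𝕜 F)) (hι : ‖ι‖ ≤ 1)
    {I : Type*} [Fintype I] (x : I → L) (y : I → F)
    (hxy : ∀ i, ι (x i) = NormedSpace.inclusionInDoubleDual 𝕜 F (y i)) {ε : ℝ} (hε : 0 < ε) :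
    ∃ T : L →L[𝕜] F, ‖T‖ ≤ 1 + ε ∧ ∀ i, ‖T (x i) - y i‖ < ε := by
  have : ProperSpace L := FiniteDimensional.proper 𝕜 L
  -- Chosen so that `(1 + η) / (1 - η) = 1 + ε`. Sending an `η`-net of the unit ball into balls of
  -- radius `1 + η` gives `‖T‖ ≤ 1 + η + η ‖T‖`.
  set η : ℝ := ε / (2 + ε) with hη
  have hη0 : 0 < η := by positivity
  have hη1 : η < 1 := by rw [hη, div_lt_one (by positivity)]; linarith
  obtain ⟨t, hts, htf, hcov⟩ :=
    (isCompact_closedBall (0 : L) 1).finite_cover_balls hη0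
  have := htf.fintype
  obtain ⟨T, hT⟩ := exists_clm_forall_mem_ball (ι : L →ₗ[𝕜] _) (K := t ⊕ I)
    (Sum.elim (fun k => (k : L)) x) (Sum.elim (fun _ => 0) y)
    (Sum.elim (fun _ => 1 + η) fun _ => ε) (by
      rintro (k | i) g
      · have hk : ‖(k : L)‖ ≤ 1 := by simpa using hts k.2
        have hb : ‖ι (k : L) g‖ ≤ 1 * ‖g‖ :=
          calc ‖ι (k : L) g‖ ≤ ‖ι k‖ * ‖g‖ := (ι k).le_opNorm g
            _ ≤ (‖ι‖ * ‖(k : L)‖) * ‖g‖ := by gcongr; exact ι.le_opNorm _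
            _ ≤ (1 * 1) * ‖g‖ := by gcongr
            _ = 1 * ‖g‖ := by ring
        obtain ⟨v, hv, hgv⟩ := StrongDual.exists_norm_lt_apply_eq g (z := ι (k : L) g)
          (r := 1 + η) (by positivity) (by
            rcases eq_or_ne g 0 with rfl | hg
            · right; simp
            · left
              have := norm_pos_iff.mpr hg
              nlinarith)
        exact ⟨v, by simpa using hv, hgv⟩
      · exact ⟨y i, by simpa using hε, by simp [hxy]⟩)
  refine ⟨T, ?_, fun i => by simpa [dist_eq_norm] using hT (Sum.inr i)⟩
  have hbound : ‖T‖ ≤ (1 + η) + ‖T‖ * η := by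
    refine ContinuousLinearMap.opNorm_le_of_unit_norm (𝕜 := 𝕜) (by positivity) fun z hz => ?_
    obtain ⟨k, hk, hzk⟩ := Set.mem_iUnion₂.1 (hcov (by simpa using hz.le : z ∈ Metric.closedBall 0 1))
    have h1 : ‖T k‖ < 1 + η := by simpa using hT (Sum.inl ⟨k, hk⟩)
    have h2 : ‖T (z - k)‖ ≤ ‖T‖ * η := by
      refine (T.le_opNorm _).trans ?_
      gcongr
      rw [← dist_eq_norm]
      exact (Metric.mem_ball.1 hzk).le
    calc ‖T z‖ = ‖T k + T (z - k)‖ := by rw [← map_add, add_sub_cancel]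
      _ ≤ ‖T k‖ + ‖T (z - k)‖ := norm_add_le _ _
      _ ≤ _ := by linarith
  have h3 : ‖T‖ * (1 - η) ≤ 1 + η := by linarith
  have h4 : (1 + ε) * (1 - η) = 1 + η := by rw [hη]; field_simp; ring
  exact le_of_mul_le_mul_right (h3.trans h4.ge) (by linarith)

end LocalReflexivity

/-! ### Elementary consequences of the ideal axioms. -/

namespace OperatorClass

namespace IsBanachOperatorIdeal

variable {A : OperatorClass.{u} 𝕜} (hA : A.IsBanachOperatorIdeal)
  {D E F G : Type u} [NormedAddCommGroup D] [NormedSpace 𝕜 D] [CompleteSpace D]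
  [NormedAddCommGroup E] [NormedSpace 𝕜 E] [CompleteSpace E]
  [NormedAddCommGroup F] [NormedSpace 𝕜 F] [CompleteSpace F]
  [NormedAddCommGroup G] [NormedSpace 𝕜 G] [CompleteSpace G]

include hA

theorem comp_left_mem (R : F →L[𝕜] G) {T : E →L[𝕜] F} (hT : A.Mem T) : A.Mem (R ∘L T) :=
  hA.comp_mem R T (ContinuousLinearMap.id 𝕜 E) hT

theorem comp_right_mem {T : E →L[𝕜] F} (hT : A.Mem T) (S : D →L[𝕜] E) : A.Mem (T ∘L S) :=
  hA.comp_mem (ContinuousLinearMap.id 𝕜 F) T S hT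

theorem nrm_comp_left_le (R : F →L[𝕜] G) {T : E →L[𝕜] F} (hT : A.Mem T) :
    A.nrm (R ∘L T) ≤ ‖R‖ * A.nrm T := by
  have h := hA.nrm_comp_le R T (ContinuousLinearMap.id 𝕜 E) hT
  rw [ContinuousLinearMap.comp_id] at h
  have h0 := hA.nrm_nonneg T hT
  exact h.trans (mul_le_of_le_one_right (by positivity) ContinuousLinearMap.norm_id_le)

theorem nrm_comp_right_le {T : E →L[𝕜] F} (hT : A.Mem T) (S : D →L[𝕜] E) :
    A.nrm (T ∘L S) ≤ A.nrm T * ‖S‖ := by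
  have h := hA.nrm_comp_le (ContinuousLinearMap.id 𝕜 F) T S hT
  rw [ContinuousLinearMap.id_comp] at h
  have h0 := hA.nrm_nonneg T hT
  refine h.trans ?_
  gcongr
  exact mul_le_of_le_one_left h0 ContinuousLinearMap.norm_id_le

theorem zero_mem : A.Mem (0 : E →L[𝕜] F) := by
  refine hA.mem_of_finiteRank _ ?_
  have : LinearMap.range ((0 : E →L[𝕜] F) : E →ₗ[𝕜] F) = ⊥ := by simp
  rw [this]
  infer_instance

theorem nrm_zero : A.nrm (0 : E →L[𝕜] F) = 0 := by
  simpa using hA.nrm_smul 0 (0 : E →L[𝕜] F) hA.zero_mem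

theorem neg_mem {T : E →L[𝕜] F} (hT : A.Mem T) : A.Mem (-T) := by
  simpa using hA.smul_mem (-1) T hT

theorem nrm_neg {T : E →L[𝕜] F} (hT : A.Mem T) : A.nrm (-T) = A.nrm T := by
  simpa using hA.nrm_smul (-1) T hT

theorem sub_mem {S T : E →L[𝕜] F} (hS : A.Mem S) (hT : A.Mem T) : A.Mem (S - T) := by
  simpa [sub_eq_add_neg] using hA.add_mem S (-T) hS (hA.neg_mem hT)

theorem nrm_sub_comm {S T : E →L[𝕜] F} (hS : A.Mem S) (hT : A.Mem T) :
    A.nrm (S - T) = A.nrm (T - S) := by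
  rw [← neg_sub, hA.nrm_neg (hA.sub_mem hT hS)]

theorem sum_mem {ι : Type*} (s : Finset ι) {T : ι → E →L[𝕜] F} (hT : ∀ i, A.Mem (T i)) :
    A.Mem (∑ i ∈ s, T i) := by
  classical
  induction s using Finset.induction_on with
  | empty => simpa using hA.zero_mem
  | insert i s hi ih => rw [Finset.sum_insert hi]; exact hA.add_mem _ _ (hT i) ih

theorem nrm_sum_le {ι : Type*} (s : Finset ι) {T : ι → E →L[𝕜] F} (hT : ∀ i, A.Mem (T i)) :
    A.nrm (∑ i ∈ s, T i) ≤ ∑ i ∈ s, A.nrm (T i) := by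
  classical
  induction s using Finset.induction_on with
  | empty => simpa using hA.nrm_zero.le
  | insert i s hi ih =>
    rw [Finset.sum_insert hi, Finset.sum_insert hi]
    exact (hA.nrm_add_le _ _ (hT i) (hA.sum_mem s hT)).trans (by gcongr)

theorem smulRight_mem (φ : StrongDual 𝕜 E) (y : F) : A.Mem (φ.smulRight y) := by
  refine hA.mem_of_finiteRank _ ?_
  refine Submodule.finiteDimensional_of_le (S₂ := 𝕜 ∙ y) ?_
  rintro _ ⟨x, rfl⟩
  exact Submodule.mem_span_singleton.2 ⟨φ x, rfl⟩

theorem id_ulift_mem : A.Mem (ContinuousLinearMap.id 𝕜 (ULift.{u} 𝕜)) :=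
  hA.mem_of_finiteRank _ inferInstance

theorem nrm_comp_id_ulift_le (φ : E →L[𝕜] ULift.{u} 𝕜) (y : ULift.{u} 𝕜 →L[𝕜] F) :
    A.nrm (y ∘L φ) ≤ ‖φ‖ * ‖y‖ := by
  have h := hA.nrm_comp_le y (ContinuousLinearMap.id 𝕜 (ULift.{u} 𝕜)) φ hA.id_ulift_mem
  rw [hA.nrm_id, ContinuousLinearMap.id_comp] at h
  linarith

theorem nrm_smulRight_le (φ : StrongDual 𝕜 E) (y : F) : A.nrm (φ.smulRight y) ≤ ‖φ‖ * ‖y‖ := by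
  let e : ULift.{u} 𝕜 ≃ₗᵢ[𝕜] 𝕜 := LinearIsometryEquiv.ulift 𝕜 𝕜
  let φ' : E →L[𝕜] ULift.{u} 𝕜 := (e.symm : 𝕜 →L[𝕜] ULift.{u} 𝕜) ∘L φ
  let y' : ULift.{u} 𝕜 →L[𝕜] F := (e : ULift.{u} 𝕜 →L[𝕜] 𝕜).smulRight y
  have h : φ.smulRight y = y' ∘L φ' := by
    ext x
    simp [φ', y']
  rw [h]
  refine (hA.nrm_comp_id_ulift_le φ' y').trans ?_
  gcongr
  · exact ContinuousLinearMap.opNorm_le_bound _ (norm_nonneg _) fun x => by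
      simpa [φ'] using φ.le_opNorm x
  · exact ContinuousLinearMap.opNorm_le_bound _ (norm_nonneg _) fun x => by
      simp [y', norm_smul, mul_comm]

/-- Sandwiching `T` between a map from the scalars hitting `x` and a norming functional of `T x`
produces `‖T x‖` times the identity of the scalar field, whose `A`-norm is normalised. -/
theorem norm_le_nrm {T : E →L[𝕜] F} (hT : A.Mem T) : ‖T‖ ≤ A.nrm T := by
  have h0 := hA.nrm_nonneg T hT
  refine ContinuousLinearMap.opNorm_le_bound _ h0 fun x => ?_
  obtain ⟨φ, hφ, hx⟩ := exists_dual_vector'' 𝕜 (T x)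
  let e : ULift.{u} 𝕜 ≃ₗᵢ[𝕜] 𝕜 := LinearIsometryEquiv.ulift 𝕜 𝕜
  let R : F →L[𝕜] ULift.{u} 𝕜 := (e.symm : 𝕜 →L[𝕜] ULift.{u} 𝕜) ∘L φ
  let S : ULift.{u} 𝕜 →L[𝕜] E := (e : ULift.{u} 𝕜 →L[𝕜] 𝕜).smulRight x
  have hR : ‖R‖ ≤ 1 := ContinuousLinearMap.opNorm_le_bound _ zero_le_one fun y => by
    have : ‖φ y‖ ≤ 1 * ‖y‖ := φ.le_of_opNorm_le hφ y
    simpa [R] using this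
  have hS : ‖S‖ ≤ ‖x‖ := ContinuousLinearMap.opNorm_le_bound _ (norm_nonneg _) fun y => by
    simp [S, norm_smul, mul_comm]
  have hid : R ∘L T ∘L S = (‖T x‖ : 𝕜) • ContinuousLinearMap.id 𝕜 (ULift.{u} 𝕜) := by
    ext y
    simp only [R, S, ContinuousLinearMap.comp_apply, ContinuousLinearMap.smulRight_apply, map_smul,
      hx]
    exact mul_comm _ _
  have h := hA.nrm_comp_le R T S hT
  rw [hid, hA.nrm_smul _ _ hA.id_ulift_mem, hA.nrm_id, RCLike.norm_ofReal, abs_norm,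
    mul_one] at h
  calc ‖T x‖ ≤ ‖R‖ * A.nrm T * ‖S‖ := h
    _ ≤ 1 * A.nrm T * ‖x‖ := by gcongr
    _ = A.nrm T * ‖x‖ := by rw [one_mul]

/-- An operator-norm limit of an `A`-Cauchy sequence is a limit in `A`. -/
theorem mem_and_tendsto_of_cauchy {T : ℕ → E →L[𝕜] F} (hT : ∀ n, A.Mem (T n))
    (hc : ∀ ε : ℝ, 0 < ε → ∃ N : ℕ, ∀ m ≥ N, ∀ n ≥ N, A.nrm (T m - T n) < ε)
    {S : E →L[𝕜] F} (hS : Tendsto T atTop (𝓝 S)) :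
    A.Mem S ∧ Tendsto (fun n => A.nrm (T n - S)) atTop (𝓝 0) := by
  obtain ⟨S', hS', hlim⟩ := hA.complete T hT hc
  have : Tendsto T atTop (𝓝 S') := by
    rw [tendsto_iff_norm_sub_tendsto_zero]
    exact squeeze_zero (fun _ => norm_nonneg _)
      (fun n => hA.norm_le_nrm (hA.sub_mem (hT n) hS')) hlim
  obtain rfl := tendsto_nhds_unique hS this
  exact ⟨hS', hlim⟩

theorem mem_and_nrm_le_of_hasSum {R : ℕ → E →L[𝕜] F} (hR : ∀ n, A.Mem (R n)) {a : ℕ → ℝ} {c : ℝ}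
    (ha : HasSum a c) (hRa : ∀ n, A.nrm (R n) ≤ a n) {S : E →L[𝕜] F} (hS : HasSum R S) :
    A.Mem S ∧ A.nrm S ≤ c := by
  have ha0 : ∀ n, 0 ≤ a n := fun n => (hA.nrm_nonneg _ (hR n)).trans (hRa n)
  set T : ℕ → E →L[𝕜] F := fun n => ∑ i ∈ Finset.range n, R i with hTdef
  set b : ℕ → ℝ := fun n => ∑ i ∈ Finset.range n, a i with hb
  have hT : ∀ n, A.Mem (T n) := fun n => hA.sum_mem _ hR
  have hle : ∀ m n, m ≤ n → A.nrm (T n - T m) ≤ b n - b m := fun m n hmn => by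
    rw [hTdef, hb]
    simp only [← Finset.sum_Ico_eq_sub _ hmn]
    exact (hA.nrm_sum_le _ hR).trans (Finset.sum_le_sum fun i _ => hRa i)
  have hbc : CauchySeq b := ha.tendsto_sum_nat.cauchySeq
  obtain ⟨hSm, hlim⟩ := hA.mem_and_tendsto_of_cauchy hT (fun ε hε => by
    obtain ⟨N, hN⟩ := Metric.cauchySeq_iff.1 hbc ε hε
    refine ⟨N, fun m hm n hn => ?_⟩
    have h1 := hN m hm n hn
    rw [Real.dist_eq] at h1
    rcases le_total m n with h | h
    · rw [hA.nrm_sub_comm (hT m) (hT n)]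
      rw [abs_sub_comm] at h1
      exact ((hle m n h).trans (le_abs_self _)).trans_lt h1
    · exact ((hle n m h).trans (le_abs_self _)).trans_lt h1) hS.tendsto_sum_nat
  refine ⟨hSm, ?_⟩
  refine ge_of_tendsto' (x := atTop) (f := fun n => c + A.nrm (T n - S))
    (by simpa using hlim.const_add c) fun n => ?_
  have h1 : S = T n + (-(T n - S)) := by abel
  have hm := hA.sub_mem (hT n) hSm
  calc A.nrm S = A.nrm (T n + (-(T n - S))) := by rw [← h1]
    _ ≤ A.nrm (T n) + A.nrm (-(T n - S)) := hA.nrm_add_le _ _ (hT n) (hA.neg_mem hm)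
    _ ≤ c + A.nrm (T n - S) := by
      rw [hA.nrm_neg hm]
      gcongr
      exact ((hA.nrm_sum_le _ hR).trans (Finset.sum_le_sum fun i _ => hRa i)).trans
        (sum_le_hasSum _ (fun i _ => ha0 i) ha)

end IsBanachOperatorIdeal

/-! ### Covering sets by images of compact sets. -/

/-- `K ⊆ T(M)` for some `T ∈ A(X; E)` with `‖T‖_A ≤ c` and some compact `M` in the unit ball. -/
def Covers (A : OperatorClass.{u} 𝕜) {E : Type u} [NormedAddCommGroup E] [NormedSpace 𝕜 E]
    [CompleteSpace E] (K : Set E) (c : ℝ) : Prop :=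
  ∃ (X : Type u) (_ : NormedAddCommGroup X) (_ : NormedSpace 𝕜 X) (_ : CompleteSpace X)
    (T : X →L[𝕜] E) (M : Set X), A.Mem T ∧ IsCompact M ∧ M ⊆ Metric.closedBall 0 1 ∧
      K ⊆ T '' M ∧ A.nrm T ≤ c

section Covers

variable {A : OperatorClass.{u} 𝕜} (hA : A.IsBanachOperatorIdeal)
  {E F : Type u} [NormedAddCommGroup E] [NormedSpace 𝕜 E] [CompleteSpace E]
  [NormedAddCommGroup F] [NormedSpace 𝕜 F] [CompleteSpace F] {K K' : Set E} {c : ℝ}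

theorem Covers.relativelyCompact (h : A.Covers K c) : A.RelativelyCompact K := by
  obtain ⟨X, _, _, _, T, M, hT, hM, -, hK, -⟩ := h
  exact ⟨X, _, _, _, T, M, hT, hM, hK⟩

theorem Covers.mono (h : A.Covers K c) (hK : K' ⊆ K) : A.Covers K' c := by
  obtain ⟨X, _, _, _, T, M, hT, hM, hM1, hKT, hc⟩ := h
  exact ⟨X, _, _, _, T, M, hT, hM, hM1, hK.trans hKT, hc⟩

include hA

theorem bddBelow_size (K : Set E) : BddBelow {r : ℝ |
    ∃ (X : Type u) (_ : NormedAddCommGroup X) (_ : NormedSpace 𝕜 X) (_ : CompleteSpace X)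
      (T : X →L[𝕜] E) (M : Set X), A.Mem T ∧ IsCompact M ∧ M ⊆ Metric.closedBall 0 1 ∧
        K ⊆ T '' M ∧ r = A.nrm T} := by
  refine ⟨0, ?_⟩
  rintro _ ⟨X, _, _, _, T, M, hT, -, -, -, rfl⟩
  exact hA.nrm_nonneg T hT

theorem Covers.size_le (h : A.Covers K c) : A.size K ≤ c := by
  obtain ⟨X, _, _, _, T, M, hT, hM, hM1, hK, hc⟩ := h
  exact (csInf_le (bddBelow_size hA K) ⟨X, _, _, _, T, M, hT, hM, hM1, hK, rfl⟩).trans hc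

theorem size_nonneg : 0 ≤ A.size K := by
  refine Real.sInf_nonneg ?_
  rintro _ ⟨X, _, _, _, T, M, hT, -, -, -, rfl⟩
  exact hA.nrm_nonneg T hT

theorem RelativelyCompact.exists_covers (h : A.RelativelyCompact K) : ∃ c, A.Covers K c := by
  obtain ⟨X, _, _, _, T, M, hT, hM, hK⟩ := h
  obtain ⟨r, hr⟩ := hM.isBounded.subset_closedBall 0
  set s : ℝ := max r 1 with hs
  have hs0 : (0 : ℝ) < s := lt_of_lt_of_le one_pos (le_max_right _ _)
  have hs1 : (s : 𝕜) ≠ 0 := by exact_mod_cast hs0.ne'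
  refine ⟨_, X, _, _, _, (s : 𝕜) • T, (fun x => (s : 𝕜)⁻¹ • x) '' M, hA.smul_mem _ _ hT,
    hM.image (continuous_const_smul _), ?_, ?_, le_rfl⟩
  · rintro _ ⟨x, hx, rfl⟩
    have hxr : ‖x‖ ≤ s := (by simpa using hr hx : ‖x‖ ≤ r).trans (le_max_left _ _)
    rw [mem_closedBall_zero_iff, norm_smul, norm_inv, RCLike.norm_ofReal, abs_of_pos hs0,
      inv_mul_le_iff₀ hs0, mul_one]
    exact hxr
  · rintro y hy
    obtain ⟨x, hx, rfl⟩ := hK hy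
    exact ⟨_, ⟨x, hx, rfl⟩, by simp [hs1]⟩

/-- Relative compactness is needed in addition to the size bound: the infimum over an empty set of
representations is `0` by convention. -/
theorem RelativelyCompact.covers_of_size_lt (h : A.RelativelyCompact K) (hc : A.size K < c) :
    A.Covers K c := by
  obtain ⟨c', X, i1, i2, i3, T, M, hT, hM, hM1, hK, -⟩ := h.exists_covers hA
  obtain ⟨_, ⟨X, _, _, _, T, M, hT, hM, hM1, hK, rfl⟩, hlt⟩ :=
    exists_lt_of_csInf_lt (by exact ⟨_, X, i1, i2, i3, T, M, hT, hM, hM1, hK, rfl⟩) hc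
  exact ⟨X, _, _, _, T, M, hT, hM, hM1, hK, hlt.le⟩

theorem size_le_of_forall_covers (h : ∀ ε : ℝ, 0 < ε → A.Covers K (c + ε)) : A.size K ≤ c :=
  le_of_forall_pos_le_add fun ε hε => (h ε hε).size_le hA

theorem covers_image (R : E →L[𝕜] F) (h : A.Covers K c) : A.Covers (R '' K) (‖R‖ * c) := by
  obtain ⟨X, _, _, _, T, M, hT, hM, hM1, hK, hc⟩ := h
  refine ⟨X, _, _, _, R ∘L T, M, hA.comp_left_mem R hT, hM, hM1, ?_,
    (hA.nrm_comp_left_le R hT).trans (by gcongr)⟩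
  rw [ContinuousLinearMap.coe_comp, Set.image_comp]
  exact Set.image_mono hK

end Covers

end OperatorClass

/-! ### Gluing countably many operators over an `ℓ¹`-sum. -/

namespace OperatorClass

theorem _root_.ContinuousLinearMap.hasSum_apply {E F : Type*} [NormedAddCommGroup E]
    [NormedSpace 𝕜 E] [NormedAddCommGroup F] [NormedSpace 𝕜 F] {R : ℕ → E →L[𝕜] F} {S : E →L[𝕜] F}
    (h : HasSum R S) (x : E) : HasSum (fun n => R n x) (S x) :=
  (ContinuousLinearMap.apply 𝕜 F x).hasSum h

theorem exists_sum_space (X : ℕ → Type u) [∀ n, NormedAddCommGroup (X n)]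
    [∀ n, NormedSpace 𝕜 (X n)] [∀ n, CompleteSpace (X n)] :
    ∃ (Y : Type u) (_ : NormedAddCommGroup Y) (_ : NormedSpace 𝕜 Y) (_ : CompleteSpace Y)
      (π : ∀ n, Y →L[𝕜] X n) (σ : ∀ n, X n →L[𝕜] Y), (∀ n, ‖π n‖ ≤ 1) ∧
      (∀ n x, ‖σ n x‖ ≤ ‖x‖) ∧ (∀ n x, π n (σ n x) = x) ∧ ∀ n k x, k ≠ n → π k (σ n x) = 0 := by
  refine ⟨lp X 1, inferInstance, inferInstance, inferInstance, fun n => lp.evalCLM 𝕜 X 1 n,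
    fun n => lp.singleContinuousLinearMap 𝕜 X 1 n, fun n => ?_, fun n x => ?_, fun n x => ?_,
    fun n k x hk => ?_⟩
  · exact LinearMap.mkContinuous_norm_le _ zero_le_one _
  · exact (lp.norm_single one_pos n x).le
  · exact lp.single_apply_self 1 n x
  · exact lp.single_apply_ne 1 n x hk

/-- Sums `∑ R n (m n)`, with `m n` running over compact subsets of unit balls and the norms of the
operators `R n` decaying geometrically, form a relatively `A`-compact set. -/
theorem covers_of_hasSum {A : OperatorClass.{u} 𝕜} (hA : A.IsBanachOperatorIdeal)
    {F : Type u} [NormedAddCommGroup F] [NormedSpace 𝕜 F] [CompleteSpace F]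
    {X : ℕ → Type u} [∀ n, NormedAddCommGroup (X n)] [∀ n, NormedSpace 𝕜 (X n)]
    [∀ n, CompleteSpace (X n)] (R : ∀ n, X n →L[𝕜] F) (M : ∀ n, Set (X n)) {a δ : ℝ}
    (hδ0 : 0 < δ) (hδ1 : δ < 1) (hR : ∀ n, A.Mem (R n)) (hRa : ∀ n, A.nrm (R n) ≤ a * (δ ^ n) ^ 2)
    (hM : ∀ n, IsCompact (M n)) (hM1 : ∀ n, M n ⊆ Metric.closedBall 0 1) {K : Set F}
    (hK : ∀ y ∈ K, ∃ m : ∀ n, X n, (∀ n, m n ∈ M n) ∧ HasSum (fun n => R n (m n)) y) :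
    A.Covers K (a * (1 - δ)⁻¹ ^ 2) := by
  have h1δ : 0 < 1 - δ := by linarith
  -- Weights of total mass one, to be moved from the operators to the compact sets. One factor `δ ^
  -- n` of the bound pays for dividing by `l n`, the other keeps the series of operators convergent.
  set l : ℕ → ℝ := fun n => (1 - δ) * δ ^ n with hl
  have hl0 : ∀ n, 0 < l n := fun n => by positivity
  have hl0' : ∀ n, (l n : 𝕜) ≠ 0 := fun n => by exact_mod_cast (hl0 n).ne'
  have hlsum : HasSum l 1 := by
    have := (hasSum_geometric_of_lt_one hδ0.le hδ1).mul_left (1 - δ)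
    rwa [mul_inv_cancel₀ h1δ.ne'] at this
  obtain ⟨Y, _, _, _, ev, σ, hev, hσ, hevσ, hevσ'⟩ := exists_sum_space (𝕜 := 𝕜) X
  let R' : ∀ n, Y →L[𝕜] F := fun n => ((l n)⁻¹ : 𝕜) • (R n ∘L ev n)
  have hR' : ∀ n, A.Mem (R' n) := fun n => hA.smul_mem _ _ (hA.comp_right_mem (hR n) _)
  have hR'a : ∀ n, A.nrm (R' n) ≤ a * (1 - δ)⁻¹ * δ ^ n := fun n => by
    have h0 := hA.nrm_nonneg _ (hR n)
    rw [hA.nrm_smul _ _ (hA.comp_right_mem (hR n) _), norm_inv, RCLike.norm_ofReal,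
      abs_of_pos (hl0 n)]
    calc (l n)⁻¹ * A.nrm (R n ∘L ev n) ≤ (l n)⁻¹ * (A.nrm (R n) * ‖ev n‖) := by
          have := (hl0 n).le
          gcongr
          exact hA.nrm_comp_right_le (hR n) _
      _ ≤ (l n)⁻¹ * ((a * (δ ^ n) ^ 2) * 1) := by
          have := (hl0 n).le
          have := h0.trans (hRa n)
          gcongr
          · exact hRa n
          · exact hev n
      _ = _ := by
          rw [hl]
          field_simp
  have hasum : HasSum (fun n => a * (1 - δ)⁻¹ * δ ^ n) (a * (1 - δ)⁻¹ ^ 2) := by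
    have := (hasSum_geometric_of_lt_one hδ0.le hδ1).mul_left (a * (1 - δ)⁻¹)
    rwa [mul_assoc, ← sq] at this
  have hR'_apply : ∀ n y, R' n y = ((l n)⁻¹ : 𝕜) • R n (ev n y) := fun _ _ => rfl
  clear_value R'
  obtain ⟨R₀, hR₀⟩ : Summable R' := Summable.of_norm_bounded hasum.summable fun n =>
    (hA.norm_le_nrm (hR' n)).trans (hR'a n)
  obtain ⟨hR₀m, hR₀n⟩ := hA.mem_and_nrm_le_of_hasSum hR' hasum hR'a hR₀
  have hsingle : ∀ n (x : X n), R₀ (σ n x) = ((l n)⁻¹ : 𝕜) • R n x := fun n x => by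
    have h1 : HasSum (fun k => R' k (σ n x)) (R₀ (σ n x)) :=
      ContinuousLinearMap.hasSum_apply hR₀ (σ n x)
    have h2 : HasSum (fun k => R' k (σ n x)) (R' n (σ n x)) :=
      hasSum_single n fun k hk => by
        rw [hR'_apply, hevσ' n k x hk, map_zero, smul_zero]
    rw [h1.unique h2, hR'_apply, hevσ]
  have := fun n => isCompact_iff_compactSpace.1 (hM n)
  -- The covering compact set is the image of the product of the `M n`, compact by Tychonoff, under
  -- the continuous map `m ↦ ∑ l n • σ n (m n)`; since the weights sum to one it lies in the unit
  -- ball.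
  let term : ∀ n, (∀ n, M n) → Y := fun n m => (l n : 𝕜) • σ n (m n : X n)
  have hterm : ∀ n m, ‖term n m‖ ≤ l n := fun n m => by
    have h1 : ‖(m n : X n)‖ ≤ 1 := by simpa using hM1 n (m n).2
    rw [norm_smul, RCLike.norm_ofReal, abs_of_pos (hl0 n)]
    exact mul_le_of_le_one_right (hl0 n).le ((hσ n _).trans h1)
  have hcont : Continuous fun m => ∑' n, term n m := by
    refine continuous_tsum (fun n => ?_) hlsum.summable hterm
    exact ((σ n).continuous.comp
      (continuous_subtype_val.comp (continuous_apply n))).const_smul _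
  refine ⟨Y, inferInstance, inferInstance, inferInstance, R₀,
    Set.range fun m => ∑' n, term n m, hR₀m, isCompact_range hcont, ?_, ?_, hR₀n⟩
  · rintro _ ⟨m, rfl⟩
    rw [mem_closedBall_zero_iff]
    exact tsum_of_norm_bounded hlsum fun n => hterm n m
  · intro y hy
    obtain ⟨m, hm, hsum⟩ := hK y hy
    refine ⟨_, ⟨fun n => ⟨m n, hm n⟩, rfl⟩, ?_⟩
    have hs : Summable fun n => term n fun n => ⟨m n, hm n⟩ :=
      Summable.of_norm_bounded hlsum.summable fun n => hterm n fun n => ⟨m n, hm n⟩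
    refine (R₀.hasSum hs.hasSum).unique ?_
    convert hsum using 2 with n
    simp [term, hsingle, hl0']

theorem norm_apply_le_of_covers {A : OperatorClass.{u} 𝕜} (hA : A.IsBanachOperatorIdeal)
    {E : Type u} [NormedAddCommGroup E] [NormedSpace 𝕜 E] [CompleteSpace E] {K : Set E} {c : ℝ}
    (h : A.Covers K c) {x : E} (hx : x ∈ K) : ‖x‖ ≤ c := by
  obtain ⟨X, _, _, _, T, M, hT, hM, hM1, hK, hc⟩ := h
  obtain ⟨m, hm, rfl⟩ := hK hx
  have hm1 : ‖m‖ ≤ 1 := by simpa using hM1 hm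
  calc ‖T m‖ ≤ ‖T‖ * ‖m‖ := T.le_opNorm m
    _ ≤ ‖T‖ * 1 := by gcongr
    _ ≤ c := by rw [mul_one]; exact (hA.norm_le_nrm hT).trans hc

/-! ### The `A`-compact operators form a Banach operator ideal. -/

section CompactOperators

variable {A : OperatorClass.{u} 𝕜} (hA : A.IsBanachOperatorIdeal)
  {D E F G : Type u} [NormedAddCommGroup D] [NormedSpace 𝕜 D] [CompleteSpace D]
  [NormedAddCommGroup E] [NormedSpace 𝕜 E] [CompleteSpace E]
  [NormedAddCommGroup F] [NormedSpace 𝕜 F] [CompleteSpace F]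
  [NormedAddCommGroup G] [NormedSpace 𝕜 G] [CompleteSpace G]

include hA

theorem compactOperators_covers {T : E →L[𝕜] F} (hT : A.compactOperators.Mem T) {c : ℝ}
    (hc : A.compactOperators.nrm T < c) : A.Covers (T '' Metric.closedBall 0 1) c :=
  RelativelyCompact.covers_of_size_lt hA hT hc

theorem compactOperators_covers_add {T : E →L[𝕜] F} (hT : A.compactOperators.Mem T) {ε : ℝ}
    (hε : 0 < ε) : A.Covers (T '' Metric.closedBall 0 1) (A.compactOperators.nrm T + ε) :=
  compactOperators_covers hA hT (by linarith)

theorem norm_le_compactOperators_nrm {T : E →L[𝕜] F} (hT : A.compactOperators.Mem T) :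
    ‖T‖ ≤ A.compactOperators.nrm T := by
  refine le_of_forall_pos_le_add fun ε hε => ?_
  have h0 : 0 ≤ A.compactOperators.nrm T := size_nonneg hA
  refine ContinuousLinearMap.opNorm_le_of_unit_norm (𝕜 := 𝕜) (by positivity) fun x hx => ?_
  exact norm_apply_le_of_covers hA (compactOperators_covers_add hA hT hε)
    ⟨x, by simpa using hx.le, rfl⟩

/-- The sup norm on `X × X'` keeps `M ×ˢ M'` in the unit ball and makes both projections
contractive, so the bounds add exactly. -/
theorem Covers.add {K K' : Set F} {c c' : ℝ} (h : A.Covers K c) (h' : A.Covers K' c') :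
    A.Covers (Set.image2 (· + ·) K K') (c + c') := by
  obtain ⟨X, _, _, _, T, M, hT, hM, hM1, hK, hc⟩ := h
  obtain ⟨X', _, _, _, T', M', hT', hM', hM1', hK', hc'⟩ := h'
  have hfst := hA.comp_right_mem hT (ContinuousLinearMap.fst 𝕜 X X')
  have hsnd := hA.comp_right_mem hT' (ContinuousLinearMap.snd 𝕜 X X')
  refine ⟨X × X', inferInstance, inferInstance, inferInstance,
    T ∘L ContinuousLinearMap.fst 𝕜 X X' + T' ∘L ContinuousLinearMap.snd 𝕜 X X', M ×ˢ M',
    hA.add_mem _ _ hfst hsnd, hM.prod hM', ?_, ?_, ?_⟩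
  · rintro ⟨x, x'⟩ ⟨hx, hx'⟩
    rw [mem_closedBall_zero_iff]
    exact max_le (by simpa using hM1 hx) (by simpa using hM1' hx')
  · rintro _ ⟨_, hy, _, hy', rfl⟩
    obtain ⟨x, hx, rfl⟩ := hK hy
    obtain ⟨x', hx', rfl⟩ := hK' hy'
    exact ⟨(x, x'), ⟨hx, hx'⟩, rfl⟩
  · refine (hA.nrm_add_le _ _ hfst hsnd).trans (add_le_add ?_ ?_)
    · refine ((hA.nrm_comp_right_le hT _).trans
        (mul_le_of_le_one_right (hA.nrm_nonneg _ hT) ?_)).trans hc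
      exact ContinuousLinearMap.norm_fst_le _ _ _
    · refine ((hA.nrm_comp_right_le hT' _).trans
        (mul_le_of_le_one_right (hA.nrm_nonneg _ hT') ?_)).trans hc'
      exact ContinuousLinearMap.norm_snd_le _ _ _

omit [CompleteSpace E] in
theorem relativelyCompact_image_of_finiteRank (T : E →L[𝕜] F)
    (hT : FiniteDimensional 𝕜 (LinearMap.range (T : E →ₗ[𝕜] F))) :
    A.RelativelyCompact (T '' Metric.closedBall 0 1) := by
  have : ProperSpace (LinearMap.range (T : E →ₗ[𝕜] F)) := FiniteDimensional.proper 𝕜 _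
  have : CompleteSpace (LinearMap.range (T : E →ₗ[𝕜] F)) := FiniteDimensional.complete 𝕜 _
  refine ⟨LinearMap.range (T : E →ₗ[𝕜] F), inferInstance, inferInstance, inferInstance,
    Submodule.subtypeL _, Metric.closedBall 0 ‖T‖, hA.mem_of_finiteRank _ ?_,
    isCompact_closedBall _ _, ?_⟩
  · have : LinearMap.range ((Submodule.subtypeL (LinearMap.range (T : E →ₗ[𝕜] F)) :
        LinearMap.range (T : E →ₗ[𝕜] F) →L[𝕜] F) : LinearMap.range (T : E →ₗ[𝕜] F) →ₗ[𝕜] F) =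
        LinearMap.range (T : E →ₗ[𝕜] F) := by simp
    rw [this]
    exact hT
  · rintro _ ⟨x, hx, rfl⟩
    refine ⟨⟨T x, x, rfl⟩, ?_, rfl⟩
    rw [mem_closedBall_zero_iff] at hx ⊢
    exact T.unit_le_opNorm x hx

omit [CompleteSpace D] [CompleteSpace E] in
theorem compactOperators_covers_comp (R : F →L[𝕜] G) (T : E →L[𝕜] F) (S : D →L[𝕜] E) {c : ℝ}
    (h : A.Covers (T '' Metric.closedBall 0 1) c) :
    A.Covers ((R ∘L T ∘L S) '' Metric.closedBall 0 1) (‖R‖ * c * ‖S‖) := by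
  have h1 := covers_image hA ((‖S‖ : 𝕜) • R) h
  rw [norm_smul, RCLike.norm_ofReal, abs_norm] at h1
  have h2 : ‖S‖ * ‖R‖ * c = ‖R‖ * c * ‖S‖ := by ring
  rw [h2] at h1
  refine h1.mono ?_
  rintro _ ⟨x, hx, rfl⟩
  rcases eq_or_ne S 0 with rfl | hS
  · exact ⟨T 0, ⟨0, by simp, rfl⟩, by simp⟩
  have hS0 : (‖S‖ : 𝕜) ≠ 0 := by simpa using hS
  refine ⟨T ((‖S‖ : 𝕜)⁻¹ • S x), ⟨_, ?_, rfl⟩, by simp [hS]⟩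
  rw [mem_closedBall_zero_iff] at hx ⊢
  rw [norm_smul, norm_inv, RCLike.norm_ofReal, abs_norm, inv_mul_le_iff₀ (norm_pos_iff.mpr hS),
    mul_one]
  exact S.unit_le_opNorm x hx

theorem compactOperators_comp_mem (R : F →L[𝕜] G) (T : E →L[𝕜] F) (S : D →L[𝕜] E)
    (hT : A.compactOperators.Mem T) : A.compactOperators.Mem (R ∘L T ∘L S) :=
  (compactOperators_covers_comp hA R T S
    (compactOperators_covers_add hA hT one_pos)).relativelyCompact

theorem compactOperators_nrm_comp_le (R : F →L[𝕜] G) (T : E →L[𝕜] F) (S : D →L[𝕜] E)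
    (hT : A.compactOperators.Mem T) :
    A.compactOperators.nrm (R ∘L T ∘L S) ≤ ‖R‖ * A.compactOperators.nrm T * ‖S‖ := by
  have hlim : Tendsto (fun ε : ℝ => ‖R‖ * (A.compactOperators.nrm T + ε) * ‖S‖) (𝓝[>] 0)
      (𝓝 (‖R‖ * (A.compactOperators.nrm T + 0) * ‖S‖)) :=
    (Continuous.tendsto (by fun_prop) 0).mono_left nhdsWithin_le_nhds
  rw [add_zero] at hlim
  refine ge_of_tendsto hlim (eventually_nhdsWithin_of_forall fun ε hε => ?_)
  exact (compactOperators_covers_comp hA R T S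
    (compactOperators_covers_add hA hT hε)).size_le hA

theorem compactOperators_smul_mem (c : 𝕜) (T : E →L[𝕜] F) (hT : A.compactOperators.Mem T) :
    A.compactOperators.Mem (c • T) := by
  simpa using compactOperators_comp_mem hA (c • ContinuousLinearMap.id 𝕜 F) T
    (ContinuousLinearMap.id 𝕜 E) hT

theorem compactOperators_nrm_smul_le (c : 𝕜) (T : E →L[𝕜] F) (hT : A.compactOperators.Mem T) :
    A.compactOperators.nrm (c • T) ≤ ‖c‖ * A.compactOperators.nrm T := by
  have h := compactOperators_nrm_comp_le hA (c • ContinuousLinearMap.id 𝕜 F) T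
    (ContinuousLinearMap.id 𝕜 E) hT
  have h0 : 0 ≤ A.compactOperators.nrm T := size_nonneg hA
  rw [ContinuousLinearMap.comp_id, ContinuousLinearMap.smul_comp,
    ContinuousLinearMap.id_comp, norm_smul] at h
  calc _ ≤ _ := h
    _ ≤ ‖c‖ * 1 * A.compactOperators.nrm T * 1 := by
      gcongr <;> exact ContinuousLinearMap.norm_id_le
    _ = _ := by ring

omit [CompleteSpace E] in
theorem compactOperators_covers_add_image {S T : E →L[𝕜] F} {c c' : ℝ}
    (hS : A.Covers (S '' Metric.closedBall 0 1) c)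
    (hT : A.Covers (T '' Metric.closedBall 0 1) c') :
    A.Covers ((S + T) '' Metric.closedBall 0 1) (c + c') := by
  refine (hS.add hA hT).mono ?_
  rintro _ ⟨x, hx, rfl⟩
  exact ⟨S x, ⟨x, hx, rfl⟩, T x, ⟨x, hx, rfl⟩, rfl⟩

theorem compactOperators_add_mem (S T : E →L[𝕜] F) (hS : A.compactOperators.Mem S)
    (hT : A.compactOperators.Mem T) : A.compactOperators.Mem (S + T) :=
  (compactOperators_covers_add_image hA (compactOperators_covers_add hA hS one_pos)
    (compactOperators_covers_add hA hT one_pos)).relativelyCompact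

theorem compactOperators_nrm_add_le (S T : E →L[𝕜] F) (hS : A.compactOperators.Mem S)
    (hT : A.compactOperators.Mem T) :
    A.compactOperators.nrm (S + T) ≤ A.compactOperators.nrm S + A.compactOperators.nrm T := by
  refine size_le_of_forall_covers hA fun ε hε => ?_
  convert compactOperators_covers_add_image hA (compactOperators_covers_add hA hS (half_pos hε))
    (compactOperators_covers_add hA hT (half_pos hε)) using 1
  ring

theorem compactOperators_sub_mem {S T : E →L[𝕜] F} (hS : A.compactOperators.Mem S)
    (hT : A.compactOperators.Mem T) : A.compactOperators.Mem (S - T) := by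
  simpa [sub_eq_add_neg] using
    compactOperators_add_mem hA S _ hS (compactOperators_smul_mem hA (-1) T hT)

/-- The operator-norm limit `S` is the only candidate. Each `T n - S` telescopes along a rapidly
Cauchy subsequence starting at `T n`, and `covers_of_hasSum` glues the covers of the increments. -/
theorem compactOperators_complete (T : ℕ → E →L[𝕜] F) (hT : ∀ n, A.compactOperators.Mem (T n))
    (hc : ∀ ε : ℝ, 0 < ε → ∃ N : ℕ, ∀ m ≥ N, ∀ n ≥ N, A.compactOperators.nrm (T m - T n) < ε) :
    ∃ S : E →L[𝕜] F, A.compactOperators.Mem S ∧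
      Tendsto (fun n => A.compactOperators.nrm (T n - S)) atTop (𝓝 0) := by
  have hcauchy : CauchySeq T := Metric.cauchySeq_iff.2 fun ε hε => by
    obtain ⟨N, hN⟩ := hc ε hε
    refine ⟨N, fun m hm n hn => ?_⟩
    rw [dist_eq_norm]
    exact (norm_le_compactOperators_nrm hA (compactOperators_sub_mem hA (hT m) (hT n))).trans_lt
      (hN m hm n hn)
  obtain ⟨S, hS⟩ := cauchySeq_tendsto_of_complete hcauchy
  have key : ∀ ε : ℝ, 0 < ε → ∃ N, ∀ n ≥ N,
      A.Covers ((T n - S) '' Metric.closedBall 0 1) ε := fun ε hε => by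
    -- The factor `(1 - 1/2)⁻² = 4` from `covers_of_hasSum` cancels the denominator of `ε / 4`.
    choose N hN using fun k : ℕ => hc (ε / 4 * ((1 / 2) ^ k) ^ 2) (by positivity)
    refine ⟨N 0, fun n hn => ?_⟩
    -- An increasing sequence with `p 0 = n` and `p k ≥ N k`, so that consecutive indices both lie
    -- beyond `N k`.
    set p : ℕ → ℕ := fun k => n + k + ∑ j ∈ Finset.range k, N (j + 1) with hp
    have hpN : ∀ k, N k ≤ p k := by
      rintro (_ | k)
      · simpa [hp] using hn
      · rw [hp]
        simp only [Finset.sum_range_succ]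
        omega
    have hpN' : ∀ k, N k ≤ p (k + 1) := fun k => (hpN k).trans (by
      rw [hp]
      simp only [Finset.sum_range_succ]
      omega)
    have hcov : ∀ k, A.Covers ((T (p k) - T (p (k + 1))) '' Metric.closedBall 0 1)
        (ε / 4 * ((1 / 2) ^ k) ^ 2) := fun k =>
      compactOperators_covers hA (compactOperators_sub_mem hA (hT _) (hT _))
        (hN k _ (hpN k) _ (hpN' k))
    have hcov' := hcov
    choose X i1 i2 i3 R M hR hM hM1 hK hRc using hcov'
    have hplim : Tendsto p atTop atTop :=
      tendsto_atTop_mono (fun k => by rw [hp]; simp only [id]; omega) tendsto_id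
    have hfin := covers_of_hasSum hA R M (by norm_num) (by norm_num) hR hRc hM hM1
      (K := (T n - S) '' Metric.closedBall 0 1) (by
        rintro _ ⟨x, hx, rfl⟩
        choose m hm hmx using fun k => hK k ⟨x, hx, rfl⟩
        refine ⟨m, hm, ?_⟩
        simp only [hmx]
        have hs : Summable fun k => (T (p k) - T (p (k + 1))) x := by
          refine Summable.of_norm_bounded (g := fun k : ℕ => ε / 4 * (1 / 4) ^ k)
            ((summable_geometric_of_lt_one (by norm_num) (by norm_num)).mul_left _) fun k => ?_
          have h1 : ((1 / 2 : ℝ) ^ k) ^ 2 = (1 / 4) ^ k := by rw [pow_right_comm]; norm_num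
          rw [← h1]
          exact norm_apply_le_of_covers hA (hcov k) ⟨x, hx, rfl⟩
        refine (hs.hasSum_iff_tendsto_nat).2 ?_
        simp only [sub_apply, Finset.sum_range_sub' fun k => T (p k) x]
        have hp0 : p 0 = n := by simp [hp]
        rw [hp0]
        exact tendsto_const_nhds.sub
          (((ContinuousLinearMap.apply 𝕜 F x).continuous.tendsto S).comp (hS.comp hplim)))
    convert hfin using 1
    norm_num
  obtain ⟨N₁, hN₁⟩ := key 1 one_pos
  have hmem : ∀ n ≥ N₁, A.compactOperators.Mem (T n - S) := fun n hn =>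
    (hN₁ n hn).relativelyCompact
  refine ⟨S, ?_, ?_⟩
  · have := compactOperators_sub_mem hA (hT N₁) (hmem N₁ le_rfl)
    rwa [sub_sub_cancel] at this
  · refine tendsto_order.2 ⟨fun a ha => Eventually.of_forall fun n =>
      ha.trans_le (size_nonneg hA), fun a ha => ?_⟩
    obtain ⟨N, hN⟩ := key (a / 2) (half_pos ha)
    filter_upwards [eventually_ge_atTop N] with n hn
    exact ((hN n hn).size_le hA).trans_lt (half_lt_self ha)

/-- The `A`-compact operators form a Banach operator ideal. -/
theorem IsBanachOperatorIdeal.compactOperators : A.compactOperators.IsBanachOperatorIdeal where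
  mem_of_finiteRank _ _ _ _ _ _ _ _ T hT := relativelyCompact_image_of_finiteRank hA T hT
  add_mem _ _ _ _ _ _ _ _ S T hS hT := compactOperators_add_mem hA S T hS hT
  smul_mem _ _ _ _ _ _ _ _ c T hT := compactOperators_smul_mem hA c T hT
  comp_mem _ _ _ _ _ _ _ _ _ _ _ _ _ _ _ _ R T S hT := compactOperators_comp_mem hA R T S hT
  nrm_nonneg _ _ _ _ _ _ _ _ _ _ := size_nonneg hA
  eq_zero_of_nrm_eq_zero _ _ _ _ _ _ _ _ T hT h0 :=
    norm_le_zero_iff.1 ((norm_le_compactOperators_nrm hA hT).trans h0.le)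
  nrm_add_le _ _ _ _ _ _ _ _ S T hS hT := compactOperators_nrm_add_le hA S T hS hT
  nrm_smul _ _ _ _ _ _ _ _ c T hT := by
    refine le_antisymm (compactOperators_nrm_smul_le hA c T hT) ?_
    rcases eq_or_ne c 0 with rfl | hc
    · rw [norm_zero, zero_mul]
      exact size_nonneg hA
    · have h := compactOperators_nrm_smul_le hA c⁻¹ (c • T) (compactOperators_smul_mem hA c T hT)
      rwa [inv_smul_smul₀ hc, norm_inv, ← div_eq_inv_mul, le_div_iff₀ (norm_pos_iff.mpr hc),
        mul_comm] at h
  nrm_comp_le _ _ _ _ _ _ _ _ _ _ _ _ _ _ _ _ R T S hT :=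
    compactOperators_nrm_comp_le hA R T S hT
  nrm_id := by
    have hcov : A.Covers (ContinuousLinearMap.id 𝕜 (ULift.{u} 𝕜) '' Metric.closedBall 0 1) 1 := by
      have : ProperSpace (ULift.{u} 𝕜) := FiniteDimensional.proper 𝕜 _
      exact ⟨ULift.{u} 𝕜, inferInstance, inferInstance, inferInstance,
        ContinuousLinearMap.id 𝕜 _, Metric.closedBall 0 1, hA.id_ulift_mem,
        isCompact_closedBall _ _, subset_rfl, subset_rfl, hA.nrm_id.le⟩
    refine le_antisymm (hcov.size_le hA) ?_
    have h := norm_le_compactOperators_nrm hA (T := ContinuousLinearMap.id 𝕜 (ULift.{u} 𝕜))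
      hcov.relativelyCompact
    rwa [ContinuousLinearMap.norm_id] at h
  complete _ _ _ _ _ _ _ _ T hT hc := compactOperators_complete hA T hT hc

end CompactOperators

/-! ### Duals of Banach operator ideals. -/

section Dual

variable {B : OperatorClass.{u} 𝕜}

/-- Carries the normalisation over to isometric copies of the scalar field; it is applied to the
dual of the scalar field. -/
theorem IsBanachOperatorIdeal.nrm_id_of_contractions (hB : B.IsBanachOperatorIdeal)
    {G : Type u} [NormedAddCommGroup G] [NormedSpace 𝕜 G] [CompleteSpace G]
    (i : ULift.{u} 𝕜 →L[𝕜] G) (j : G →L[𝕜] ULift.{u} 𝕜) (hi : ‖i‖ ≤ 1) (hj : ‖j‖ ≤ 1)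
    (hij : i ∘L j = ContinuousLinearMap.id 𝕜 G)
    (hji : j ∘L i = ContinuousLinearMap.id 𝕜 (ULift.{u} 𝕜)) :
    B.nrm (ContinuousLinearMap.id 𝕜 G) = 1 := by
  have hle : B.nrm (ContinuousLinearMap.id 𝕜 G) ≤ 1 := by
    rw [← hij]
    refine (hB.nrm_comp_id_ulift_le j i).trans ?_
    exact mul_le_one₀ hj (norm_nonneg _) hi
  refine le_antisymm hle ?_
  have hG : B.Mem (ContinuousLinearMap.id 𝕜 G) := by
    rw [← hij]
    exact hB.comp_mem i _ j hB.id_ulift_mem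
  have h0 := hB.nrm_nonneg _ hG
  have h := hB.nrm_comp_le j _ i hG
  rw [ContinuousLinearMap.id_comp, hji, hB.nrm_id] at h
  calc 1 ≤ _ := h
    _ ≤ 1 * B.nrm (ContinuousLinearMap.id 𝕜 G) * 1 := by gcongr
    _ = _ := by ring

/-- The dual of a Banach operator ideal is a Banach operator ideal. -/
theorem IsBanachOperatorIdeal.dual (hB : B.IsBanachOperatorIdeal) :
    B.dual.IsBanachOperatorIdeal where
  mem_of_finiteRank E F _ _ _ _ _ _ T hT := by
    refine hB.mem_of_finiteRank (adj T) ?_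
    let T₀ : E →L[𝕜] LinearMap.range (T : E →ₗ[𝕜] F) :=
      T.codRestrict _ fun x => LinearMap.mem_range_self _ x
    have h : LinearMap.range (adj T : StrongDual 𝕜 F →ₗ[𝕜] StrongDual 𝕜 E) ≤
        LinearMap.range (adj T₀ : StrongDual 𝕜 (LinearMap.range (T : E →ₗ[𝕜] F)) →ₗ[𝕜] StrongDual 𝕜 E) := by
      rintro _ ⟨φ, rfl⟩
      exact ⟨φ ∘L Submodule.subtypeL _, rfl⟩
    exact Submodule.finiteDimensional_of_le h
  add_mem _ _ _ _ _ _ _ _ S T hS hT := by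
    change B.Mem (adj (S + T))
    rw [adj_add]
    exact hB.add_mem _ _ hS hT
  smul_mem _ _ _ _ _ _ _ _ c T hT := by
    change B.Mem (adj (c • T))
    rw [adj_smul]
    exact hB.smul_mem _ _ hT
  comp_mem _ _ _ _ _ _ _ _ _ _ _ _ _ _ _ _ R T S hT := hB.comp_mem (adj S) (adj T) (adj R) hT
  nrm_nonneg _ _ _ _ _ _ _ _ _ hT := hB.nrm_nonneg _ hT
  eq_zero_of_nrm_eq_zero _ _ _ _ _ _ _ _ T hT h0 := by
    have h := hB.norm_le_nrm hT
    rw [norm_adj] at h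
    exact norm_le_zero_iff.1 (h.trans h0.le)
  nrm_add_le _ _ _ _ _ _ _ _ S T hS hT := by
    change B.nrm (adj (S + T)) ≤ _
    rw [adj_add]
    exact hB.nrm_add_le _ _ hS hT
  nrm_smul _ _ _ _ _ _ _ _ c T hT := by
    change B.nrm (adj (c • T)) = _
    rw [adj_smul]
    exact hB.nrm_smul _ _ hT
  nrm_comp_le _ _ _ _ _ _ _ _ _ _ _ _ _ _ _ _ R T S hT := by
    have h := hB.nrm_comp_le (adj S) (adj T) (adj R) hT
    rw [norm_adj, norm_adj, mul_comm, mul_comm ‖S‖, ← mul_assoc] at h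
    exact h
  nrm_id := by
    let e : ULift.{u} 𝕜 →L[𝕜] 𝕜 :=
      (LinearIsometryEquiv.ulift 𝕜 𝕜 : ULift.{u} 𝕜 ≃ₗᵢ[𝕜] 𝕜).toLinearIsometry.toContinuousLinearMap
    let e' : 𝕜 →L[𝕜] ULift.{u} 𝕜 :=
      (LinearIsometryEquiv.ulift 𝕜 𝕜).symm.toLinearIsometry.toContinuousLinearMap
    have he : ‖e‖ ≤ 1 := LinearIsometry.norm_toContinuousLinearMap_le _
    refine hB.nrm_id_of_contractions (e.smulRight (e : StrongDual 𝕜 (ULift.{u} 𝕜)))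
      (e' ∘L ContinuousLinearMap.apply 𝕜 𝕜 (ULift.up (1 : 𝕜))) ?_ ?_ ?_ ?_
    · rw [ContinuousLinearMap.norm_smulRight_apply]
      exact mul_le_one₀ he (norm_nonneg _) he
    · refine ContinuousLinearMap.opNorm_le_bound _ zero_le_one fun φ => ?_
      have h1 : ‖(ULift.up (1 : 𝕜) : ULift.{u} 𝕜)‖ = 1 := by rw [ULift.norm_up, norm_one]
      have h2 := φ.le_opNorm (ULift.up (1 : 𝕜))
      rw [h1, mul_one] at h2
      rw [one_mul]
      exact h2
    · ext φ x
      change φ (ULift.up 1) * x.down = φ x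
      rw [mul_comm, ← smul_eq_mul, ← map_smul]
      congr 1
      ext
      simp
    · ext x
      change x.down * 1 = x.down
      rw [mul_one]
  complete _ _ _ _ _ _ _ _ T hT hc := by
    have hc' : ∀ ε : ℝ, 0 < ε → ∃ N : ℕ, ∀ m ≥ N, ∀ n ≥ N, B.nrm (adj (T m) - adj (T n)) < ε := by
      simp only [← adj_sub]
      exact hc
    -- Taking the limit of `T n` itself in operator norm ensures that the limit of the adjoints is
    -- again an adjoint.
    have hcauchy : CauchySeq T := Metric.cauchySeq_iff.2 fun ε hε => by
      obtain ⟨N, hN⟩ := hc' ε hε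
      refine ⟨N, fun m hm n hn => ?_⟩
      rw [dist_eq_norm, ← norm_adj, adj_sub]
      exact (hB.norm_le_nrm (hB.sub_mem (hT m) (hT n))).trans_lt (hN m hm n hn)
    obtain ⟨S, hS⟩ := cauchySeq_tendsto_of_complete hcauchy
    have hlim : Tendsto (fun n => adj (T n)) atTop (𝓝 (adj S)) := by
      rw [tendsto_iff_norm_sub_tendsto_zero] at hS ⊢
      simpa only [← adj_sub, norm_adj] using hS
    obtain ⟨h1, h2⟩ := hB.mem_and_tendsto_of_cauchy hT hc' hlim
    simp only [← adj_sub] at h2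
    exact ⟨S, h1, h2⟩

end Dual

end OperatorClass

/-! ### Decomposing compact sets, and the two inclusions. -/

/-- Approximate `x` by points `c n` of finer and finer finite nets and telescope: `x = c 0 + ∑ (c (n
+ 1) - c n)`. The differences come from finite sets independent of `x`. The squared decay is what
`covers_of_hasSum` consumes. -/
theorem exists_finite_sets_hasSum {Z : Type*} [NormedAddCommGroup Z] [CompleteSpace Z] {M : Set Z}
    (hM : IsCompact M) (hM1 : M ⊆ Metric.closedBall 0 1) {δ : ℝ} (hδ0 : 0 < δ) (hδ1 : δ < 1) :
    ∃ Δ : ℕ → Set Z, (∀ n, (Δ n).Finite) ∧ (∀ n, ∀ d ∈ Δ n, ‖d‖ ≤ (δ ^ n) ^ 2) ∧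
      ∀ x ∈ M, ∃ d : ℕ → Z, (∀ n, d n ∈ Δ n) ∧ HasSum d x := by
  -- The `n`-th net has half the bound for index `n + 1` as radius, so consecutive net points near
  -- the same `x` differ by at most that bound.
  have hr : ∀ n : ℕ, 0 < (δ ^ (n + 1)) ^ 2 / 2 := fun n => by positivity
  have hanti : ∀ n : ℕ, (δ ^ (n + 1)) ^ 2 ≤ (δ ^ n) ^ 2 := fun n => by
    gcongr ?_ ^ 2
    exact pow_le_pow_of_le_one hδ0.le hδ1.le n.le_succ
  choose C hCM hCf hC using fun n => hM.finite_cover_balls (hr n)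
  refine ⟨fun n => Nat.casesOn n (C 0)
    fun n => Set.image2 (· - ·) (C (n + 1)) (C n) ∩ Metric.closedBall 0 ((δ ^ (n + 1)) ^ 2),
    ?_, ?_, ?_⟩
  · rintro (_ | n)
    · exact hCf 0
    · exact ((hCf (n + 1)).image2 _ (hCf n)).subset Set.inter_subset_left
  · rintro (_ | n) d hd
    · simpa using hM1 (hCM 0 hd)
    · simpa using hd.2
  · intro x hx
    choose c hcC hc using fun n => Set.mem_iUnion₂.1 (hC n hx)
    have hc' : ∀ n, ‖x - c n‖ < (δ ^ (n + 1)) ^ 2 / 2 := fun n => by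
      rw [← dist_eq_norm]
      exact hc n
    have hdiff : ∀ n, ‖c (n + 1) - c n‖ ≤ (δ ^ (n + 1)) ^ 2 := fun n => by
      have h1 : c (n + 1) - c n = (x - c n) - (x - c (n + 1)) := by abel
      rw [h1]
      have h2 := norm_sub_le (x - c n) (x - c (n + 1))
      linarith [hc' n, hc' (n + 1), hanti (n + 1)]
    set d : ℕ → Z := fun n => Nat.casesOn n (c 0) fun n => c (n + 1) - c n with hd
    have hgeom : Summable fun n : ℕ => (δ ^ n) ^ 2 := by
      simp only [pow_right_comm δ _ 2]
      exact summable_geometric_of_lt_one (by positivity) (pow_lt_one₀ hδ0.le hδ1 two_ne_zero)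
    have hdn : ∀ n, ‖d n‖ ≤ (δ ^ n) ^ 2 := by
      rintro (_ | n)
      · simpa [hd] using hM1 (hCM 0 (hcC 0))
      · exact hdiff n
    have hsum : ∀ n, ∑ i ∈ Finset.range (n + 1), d i = c n := fun n => by
      rw [Finset.sum_range_succ']
      change ∑ i ∈ Finset.range n, (c (i + 1) - c i) + c 0 = c n
      rw [Finset.sum_range_sub, sub_add_cancel]
    refine ⟨d, ?_, ?_⟩
    · rintro (_ | n)
      · exact hcC 0
      · exact ⟨⟨_, hcC (n + 1), _, hcC n, rfl⟩, by simpa using hdiff n⟩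
    · refine ((Summable.of_norm_bounded hgeom hdn).hasSum_iff_tendsto_nat).2
        ((tendsto_add_atTop_iff_nat 1).1 ?_)
      simp only [hsum]
      rw [tendsto_iff_norm_sub_tendsto_zero]
      refine squeeze_zero (fun _ => norm_nonneg _) (fun n => ?_) hgeom.tendsto_atTop_zero
      rw [norm_sub_rev]
      linarith [hc' n, hanti n, hr n]

namespace OperatorClass

theorem Covers.adj_adj {A : OperatorClass.{u} 𝕜} (hA : A.IsBanachOperatorIdeal)
    {E F : Type u} [NormedAddCommGroup E] [NormedSpace 𝕜 E] [CompleteSpace E]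
    [NormedAddCommGroup F] [NormedSpace 𝕜 F] [CompleteSpace F] {T : E →L[𝕜] F} {c : ℝ}
    (h : A.Covers (T '' Metric.closedBall 0 1) c) :
    A.Covers (adj (adj T) '' Metric.closedBall 0 1) c := by
  obtain ⟨X, _, _, _, R, M, hR, hM, hM1, hK, hc⟩ := h
  refine ⟨X, _, _, _, NormedSpace.inclusionInDoubleDual 𝕜 F ∘L R, M, hA.comp_left_mem _ hR, hM,
    hM1, ?_, ?_⟩
  · rintro _ ⟨ξ, hξ, rfl⟩
    obtain ⟨_, ⟨x, hx, rfl⟩, hy⟩ :=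
      adj_adj_mem_of_isCompact T (hM.image R.continuous) hK ξ (by simpa using hξ)
    exact ⟨x, hx, hy.symm⟩
  · exact ((hA.nrm_comp_left_le _ hR).trans (mul_le_of_le_one_left (hA.nrm_nonneg _ hR)
      (NormedSpace.inclusionInDoubleDual_norm_le 𝕜 F))).trans hc

/-- On a finite-dimensional domain the identity is approximable, so `U = U ∘ id` bounds the norm of
`U` in `A ∘ approximable` by `‖U‖_A`. Accessibility transfers this to `A^min`; unfolding its two
infima and absorbing the right approximable factor into `Q` leaves the factorization. -/
theorem RightAccessible.exists_factorization {A : OperatorClass.{u} 𝕜}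
    (hA : A.IsBanachOperatorIdeal) (hr : A.RightAccessible)
    {X F : Type u} [NormedAddCommGroup X] [NormedSpace 𝕜 X] [CompleteSpace X]
    [FiniteDimensional 𝕜 X] [NormedAddCommGroup F] [NormedSpace 𝕜 F] [CompleteSpace F]
    (U : X →L[𝕜] F) {c : ℝ} (hc : A.nrm U < c) :
    ∃ (G : Type u) (_ : NormedAddCommGroup G) (_ : NormedSpace 𝕜 G) (_ : CompleteSpace G)
      (P : G →L[𝕜] F) (Q : X →L[𝕜] G), (approximable 𝕜).Mem P ∧ A.Mem Q ∧ U = P ∘L Q ∧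
        ‖P‖ * A.nrm Q < c := by
  have hU : A.Mem U := hA.mem_of_finiteRank U inferInstance
  have hid : (approximable 𝕜).Mem (ContinuousLinearMap.id 𝕜 X) := subset_closure (by
    change FiniteDimensional 𝕜 (LinearMap.range _)
    infer_instance)
  have hfac : ∃ (G : Type u) (_ : NormedAddCommGroup G) (_ : NormedSpace 𝕜 G)
      (_ : CompleteSpace G) (R : G →L[𝕜] F) (S : X →L[𝕜] G), A.Mem R ∧ (approximable 𝕜).Mem S ∧
        U = R ∘L S := ⟨X, _, _, _, U, _, hU, hid, rfl⟩
  have hle : (A.comp (approximable 𝕜)).nrm U ≤ A.nrm U := by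
    refine (csInf_le ?_ (by exact ⟨X, _, _, _, U, _, hU, hid, rfl, rfl⟩)).trans
      (mul_le_of_le_one_right (hA.nrm_nonneg _ hU) ContinuousLinearMap.norm_id_le)
    refine ⟨0, ?_⟩
    rintro _ ⟨G, _, _, _, R, S, hR, -, -, rfl⟩
    exact mul_nonneg (hA.nrm_nonneg _ hR) (norm_nonneg _)
  obtain ⟨h1, h2⟩ := hr U
  have hmin := h1.2 hfac
  have hlt : A.minKernel.nrm U < c := (h2 hmin).trans_lt (hle.trans_lt hc)
  obtain ⟨G₁, i1, i2, i3, R, S, hR, hS, hRS⟩ := hmin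
  obtain ⟨_, ⟨G₁, _, _, _, R, S, hR, hS, hRS, rfl⟩, hlt⟩ :=
    exists_lt_of_csInf_lt (by exact ⟨_, G₁, i1, i2, i3, R, S, hR, hS, hRS, rfl⟩) hlt
  change ((approximable 𝕜).comp A).nrm R * ‖S‖ < c at hlt
  obtain ⟨b, hb, hbc⟩ : ∃ b, ((approximable 𝕜).comp A).nrm R < b ∧ b * ‖S‖ < c := by
    have hev : ∀ᶠ b in 𝓝[>] (((approximable 𝕜).comp A).nrm R), b * ‖S‖ < c :=
      ((continuous_mul_const ‖S‖).tendsto _).mono_left nhdsWithin_le_nhds (Iio_mem_nhds hlt)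
    exact (eventually_mem_nhdsWithin.and hev).exists
  obtain ⟨G, j1, j2, j3, P, Q, hP, hQ, hPQ⟩ := hR
  obtain ⟨_, ⟨G, _, _, _, P, Q, hP, hQ, hPQ, rfl⟩, hlt'⟩ :=
    exists_lt_of_csInf_lt (by exact ⟨_, G, j1, j2, j3, P, Q, hP, hQ, hPQ, rfl⟩) hb
  change ‖P‖ * A.nrm Q < b at hlt'
  refine ⟨G, _, _, _, P, Q ∘L S, hP, hA.comp_right_mem hQ S, by rw [hRS, hPQ]; rfl, ?_⟩
  calc ‖P‖ * A.nrm (Q ∘L S) ≤ ‖P‖ * (A.nrm Q * ‖S‖) := by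
        gcongr
        exact hA.nrm_comp_right_le hQ S
    _ = ‖P‖ * A.nrm Q * ‖S‖ := by ring
    _ ≤ b * ‖S‖ := by gcongr
    _ < c := hbc

/-- A crude bound of the `A`-norm by values on a fixed basis, making operator-norm errors on a
finite-dimensional domain small in `A`. -/
theorem IsBanachOperatorIdeal.nrm_le_sum_basis {A : OperatorClass.{u} 𝕜}
    (hA : A.IsBanachOperatorIdeal) {X F : Type u} [NormedAddCommGroup X] [NormedSpace 𝕜 X]
    [CompleteSpace X] [FiniteDimensional 𝕜 X] [NormedAddCommGroup F] [NormedSpace 𝕜 F]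
    [CompleteSpace F] {ι : Type*} [Fintype ι] (b : Module.Basis ι 𝕜 X) (U : X →L[𝕜] F) :
    A.nrm U ≤ ∑ i, ‖LinearMap.toContinuousLinearMap (b.coord i)‖ * ‖U (b i)‖ := by
  have h : U = ∑ i, (LinearMap.toContinuousLinearMap (b.coord i)).smulRight (U (b i)) := by
    ext x
    conv_lhs => rw [← b.sum_repr x, map_sum]
    simp
  conv_lhs => rw [h]
  exact (hA.nrm_sum_le _ fun i => hA.smulRight_mem _ _).trans
    (Finset.sum_le_sum fun i _ => hA.nrm_smulRight_le _ _)

/-- For a right-accessible ideal, the norm of an operator with finite-dimensional domain does not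
increase when its range is regarded as part of the range space instead of the bidual. -/
theorem RightAccessible.nrm_le_nrm_inclusion_comp {A : OperatorClass.{u} 𝕜}
    (hA : A.IsBanachOperatorIdeal) (hr : A.RightAccessible)
    {X F : Type u} [NormedAddCommGroup X] [NormedSpace 𝕜 X] [CompleteSpace X]
    [FiniteDimensional 𝕜 X] [NormedAddCommGroup F] [NormedSpace 𝕜 F] [CompleteSpace F]
    (W : X →L[𝕜] F) : A.nrm W ≤ A.nrm (NormedSpace.inclusionInDoubleDual 𝕜 F ∘L W) := by
  set J := NormedSpace.inclusionInDoubleDual 𝕜 F with hJ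
  refine le_of_forall_gt_imp_ge_of_dense fun c hc => ?_
  obtain ⟨G, _, _, _, P, Q, hP, hQ, hPQ, hlt⟩ := hr.exists_factorization hA (J ∘L W) hc
  refine le_trans ?_ hlt.le
  -- The basis, `P` and `Q` are fixed before `η`, so the error sum tends to zero with `η` and the
  -- main term to `‖P‖ * A.nrm Q`.
  let b := Module.finBasis 𝕜 X
  let κ : Fin (Module.finrank 𝕜 X) → ℝ := fun i => ‖LinearMap.toContinuousLinearMap (b.coord i)‖
  have hq := hA.nrm_nonneg Q hQ
  have hlim : Tendsto (fun η : ℝ => (1 + η) * (‖P‖ + η) * A.nrm Q +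
      ∑ i, κ i * (η + (1 + η) * (η * ‖Q (b i)‖))) (𝓝[>] 0)
      (𝓝 ((1 + 0) * (‖P‖ + 0) * A.nrm Q +
        ∑ i, κ i * (0 + (1 + 0) * (0 * ‖Q (b i)‖)))) :=
    (Continuous.tendsto (by fun_prop) 0).mono_left nhdsWithin_le_nhds
  simp only [add_zero, one_mul, zero_mul, mul_zero, Finset.sum_const_zero] at hlim
  refine ge_of_tendsto hlim (eventually_nhdsWithin_of_forall fun η (hη : 0 < η) => ?_)
  obtain ⟨P₀, hP₀, hPP₀⟩ := Metric.mem_closure_iff.1 hP η hη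
  rw [dist_eq_norm] at hPP₀
  have hP₀n : ‖P₀‖ ≤ ‖P‖ + η := by
    have h1 := norm_sub_norm_le P₀ P
    rw [norm_sub_rev] at h1
    linarith
  -- `L` contains both the range of the finite rank approximant and `J W(X)`, so one map `T : L → F`
  -- lifts the former and almost inverts `J` on the latter.
  let L : Submodule 𝕜 (StrongDual 𝕜 (StrongDual 𝕜 F)) :=
    LinearMap.range (P₀ : G →ₗ[𝕜] StrongDual 𝕜 (StrongDual 𝕜 F)) ⊔
      LinearMap.range (J ∘L W : X →L[𝕜] StrongDual 𝕜 (StrongDual 𝕜 F)).toLinearMap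
  have hP₀' : FiniteDimensional 𝕜
    (LinearMap.range (P₀ : G →ₗ[𝕜] StrongDual 𝕜 (StrongDual 𝕜 F))) := hP₀
  have : FiniteDimensional 𝕜 L := Submodule.finiteDimensional_sup _ _
  have hPL : ∀ g, P₀ g ∈ L := fun g => Submodule.mem_sup_left ⟨g, rfl⟩
  have hWL : ∀ x, J (W x) ∈ L := fun x => Submodule.mem_sup_right ⟨x, rfl⟩
  obtain ⟨T, hT, hTb⟩ := exists_clm_norm_le_approx L.subtypeL (Submodule.norm_subtypeL_le L)
    (fun i => ⟨J (W (b i)), hWL _⟩) (fun i => W (b i)) (fun i => rfl) hη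
  let P₁ : G →L[𝕜] L := P₀.codRestrict L hPL
  have hP₁ : ‖P₁‖ ≤ ‖P‖ + η := by
    refine ContinuousLinearMap.opNorm_le_bound _ (by positivity) fun g => ?_
    exact P₀.le_of_opNorm_le hP₀n g
  have hTP : A.Mem ((T ∘L P₁) ∘L Q) := hA.comp_left_mem _ hQ
  have hnear : A.nrm ((T ∘L P₁) ∘L Q) ≤ (1 + η) * (‖P‖ + η) * A.nrm Q := by
    refine (hA.nrm_comp_left_le _ hQ).trans ?_
    gcongr
    exact (ContinuousLinearMap.opNorm_comp_le _ _).trans (by gcongr)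
  have herr : A.nrm (W - (T ∘L P₁) ∘L Q) ≤ ∑ i, κ i * (η + (1 + η) * (η * ‖Q (b i)‖)) := by
    refine (hA.nrm_le_sum_basis b _).trans (Finset.sum_le_sum fun i _ => ?_)
    refine mul_le_mul_of_nonneg_left ?_ (norm_nonneg _)
    -- The first error is that of local reflexivity on `J W (b i)`; the second comes from replacing
    -- `P` by `P₀`, since `J W = P Q`.
    have hdecomp : (W - (T ∘L P₁) ∘L Q) (b i) = -(T ⟨J (W (b i)), hWL _⟩ - W (b i)) +
        T (⟨J (W (b i)), hWL _⟩ - P₁ (Q (b i))) := by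
      simp
    have hJW : J (W (b i)) = P (Q (b i)) := congrArg (fun V => V (b i)) hPQ
    have hdist : ‖(⟨J (W (b i)), hWL _⟩ - P₁ (Q (b i)) : L)‖ ≤ η * ‖Q (b i)‖ := by
      change ‖J (W (b i)) - P₀ (Q (b i))‖ ≤ _
      rw [hJW]
      exact (P - P₀).le_of_opNorm_le hPP₀.le (Q (b i))
    rw [hdecomp]
    refine (norm_add_le _ _).trans (add_le_add ?_ ?_)
    · rw [norm_neg]
      exact (hTb i).le
    · exact (T.le_of_opNorm_le hT _).trans (by gcongr)
  have hW : W = (T ∘L P₁) ∘L Q + (W - (T ∘L P₁) ∘L Q) := by abel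
  calc A.nrm W = A.nrm ((T ∘L P₁) ∘L Q + (W - (T ∘L P₁) ∘L Q)) := by rw [← hW]
    _ ≤ A.nrm ((T ∘L P₁) ∘L Q) + A.nrm (W - (T ∘L P₁) ∘L Q) :=
      hA.nrm_add_le _ _ hTP (hA.mem_of_finiteRank _ inferInstance)
    _ ≤ _ := add_le_add hnear herr

/-- `R` itself need not be in `A`. Only its restrictions to the finite-dimensional spans of the sets
`Δ n` are used, where accessibility bounds their norms by that of `J R`. -/
theorem RightAccessible.covers_image {A : OperatorClass.{u} 𝕜}
    (hA : A.IsBanachOperatorIdeal) (hr : A.RightAccessible)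
    {Z F : Type u} [NormedAddCommGroup Z] [NormedSpace 𝕜 Z] [CompleteSpace Z]
    [NormedAddCommGroup F] [NormedSpace 𝕜 F] [CompleteSpace F] (R : Z →L[𝕜] F)
    (hR : A.Mem (NormedSpace.inclusionInDoubleDual 𝕜 F ∘L R)) {M : Set Z} (hM : IsCompact M)
    (hM1 : M ⊆ Metric.closedBall 0 1) {δ : ℝ} (hδ0 : 0 < δ) (hδ1 : δ < 1) :
    A.Covers (R '' M) (A.nrm (NormedSpace.inclusionInDoubleDual 𝕜 F ∘L R) * (1 - δ)⁻¹ ^ 2) := by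
  obtain ⟨Δ, hΔf, hΔ, hsum⟩ := exists_finite_sets_hasSum hM hM1 hδ0 hδ1
  let X : ℕ → Submodule 𝕜 Z := fun n => Submodule.span 𝕜 (Δ n)
  have hfin : ∀ n, FiniteDimensional 𝕜 (X n) := fun n =>
    FiniteDimensional.span_of_finite 𝕜 (hΔf n)
  have : ∀ n, CompleteSpace (X n) := fun n => FiniteDimensional.complete 𝕜 _
  have hρ0 : ∀ n : ℕ, 0 < (δ ^ n) ^ 2 := fun n => by positivity
  let ρ : ℕ → 𝕜 := fun n => (((δ ^ n) ^ 2 : ℝ) : 𝕜)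
  have hρn : ∀ n, ‖ρ n‖ = (δ ^ n) ^ 2 := fun n => by
    rw [RCLike.norm_ofReal, abs_of_pos (hρ0 n)]
  have hρ : ∀ n, ρ n ≠ 0 := fun n => by
    rw [← norm_ne_zero_iff, hρn]
    exact (hρ0 n).ne'
  -- The size of `Δ n` is shifted to the operator, so that the rescaled finite set lies in the unit
  -- ball.
  let V : ∀ n, X n →L[𝕜] Z := fun n => ρ n • (X n).subtypeL
  have hV : ∀ n, ‖V n‖ ≤ (δ ^ n) ^ 2 := fun n => by
    rw [norm_smul, hρn]
    exact mul_le_of_le_one_right (hρ0 n).le (Submodule.norm_subtypeL_le _)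
  refine covers_of_hasSum hA (fun n => R ∘L V n)
    (fun n => (fun x => (ρ n)⁻¹ • x) '' ((↑) ⁻¹' Δ n : Set (X n))) hδ0 hδ1
    (fun n => hA.mem_of_finiteRank _ inferInstance) (fun n => ?_) (fun n => ?_) (fun n => ?_) ?_
  · refine (hr.nrm_le_nrm_inclusion_comp hA (R ∘L V n)).trans ?_
    exact (hA.nrm_comp_right_le hR (V n)).trans
      (mul_le_mul_of_nonneg_left (hV n) (hA.nrm_nonneg _ hR))
  · exact (((hΔf n).preimage Subtype.val_injective.injOn).image _).isCompact
  · rintro _ ⟨x, hx, rfl⟩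
    rw [mem_closedBall_zero_iff, norm_smul, norm_inv, hρn, inv_mul_le_iff₀ (hρ0 n), mul_one]
    exact hΔ n _ hx
  · rintro _ ⟨z, hz, rfl⟩
    obtain ⟨d, hd, hdz⟩ := hsum z hz
    refine ⟨fun n => (ρ n)⁻¹ • ⟨d n, Submodule.subset_span (hd n)⟩, fun n => ⟨_, hd n, rfl⟩, ?_⟩
    convert R.hasSum hdz using 2 with n
    simp [V, hρ n]

theorem RightAccessible.covers_of_adj_adj {A : OperatorClass.{u} 𝕜}
    (hA : A.IsBanachOperatorIdeal) (hr : A.RightAccessible)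
    {E F : Type u} [NormedAddCommGroup E] [NormedSpace 𝕜 E] [CompleteSpace E]
    [NormedAddCommGroup F] [NormedSpace 𝕜 F] [CompleteSpace F] {T : E →L[𝕜] F} {c δ : ℝ}
    (h : A.Covers (adj (adj T) '' Metric.closedBall 0 1) c) (hδ0 : 0 < δ) (hδ1 : δ < 1) :
    A.Covers (T '' Metric.closedBall 0 1) (c * (1 - δ)⁻¹ ^ 2) := by
  obtain ⟨X, _, _, _, R, M, hR, hM, hM1, hK, hc⟩ := h
  let J := NormedSpace.inclusionInDoubleDualLi 𝕜 (E := F)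
  -- The part of `X` that `R` maps into the copy of `F`. It is closed because `F` is complete and
  -- embedded isometrically, so `M ∩ Z` stays compact.
  let Z : Submodule 𝕜 X := (LinearMap.range J.toLinearMap).comap R.toLinearMap
  have hZc : IsClosed (Z : Set X) := by
    have h1 : IsClosed (Set.range J) := J.isometry.isClosedEmbedding.isClosed_range
    exact h1.preimage R.continuous
  have : CompleteSpace Z := hZc.completeSpace_coe
  let R₁ : Z →L[𝕜] F := (J.equivRange.symm : LinearMap.range J.toLinearMap →L[𝕜] F) ∘L
    ((R ∘L Z.subtypeL).codRestrict (LinearMap.range J.toLinearMap) fun z => z.2)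
  have hJR : ∀ z : Z, J (R₁ z) = R z := fun z =>
    congrArg Subtype.val (J.equivRange.apply_symm_apply ⟨R z, z.2⟩)
  have hJR' : NormedSpace.inclusionInDoubleDual 𝕜 F ∘L R₁ = R ∘L Z.subtypeL :=
    ContinuousLinearMap.ext hJR
  have hmem : A.Mem (NormedSpace.inclusionInDoubleDual 𝕜 F ∘L R₁) := by
    rw [hJR']
    exact hA.comp_right_mem hR _
  have hnrm : A.nrm (NormedSpace.inclusionInDoubleDual 𝕜 F ∘L R₁) ≤ c := by
    rw [hJR']
    exact ((hA.nrm_comp_right_le hR _).trans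
      (mul_le_of_le_one_right (hA.nrm_nonneg _ hR) (Submodule.norm_subtypeL_le _))).trans hc
  obtain ⟨Y, _, _, _, S, N, hS, hN, hN1, hSN, hSc⟩ := hr.covers_image hA R₁ hmem
    (M := (↑) ⁻¹' M) (hZc.isClosedEmbedding_subtypeVal.isCompact_preimage hM)
    (fun z hz => by simpa using hM1 hz) hδ0 hδ1
  refine ⟨Y, _, _, _, S, N, hS, hN, hN1, Set.Subset.trans ?_ hSN, hSc.trans (by gcongr)⟩
  rintro _ ⟨x, hx, rfl⟩
  obtain ⟨m, hm, hmx⟩ := hK ⟨NormedSpace.inclusionInDoubleDual 𝕜 E x, by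
    rw [mem_closedBall_zero_iff] at hx ⊢
    exact (NormedSpace.double_dual_bound 𝕜 E x).trans hx, rfl⟩
  rw [adj_adj_inclusion] at hmx
  exact ⟨⟨m, T x, hmx.symm⟩, hm, J.injective ((hJR _).trans hmx)⟩

theorem compactOperators_contractivelyIncluded_dual_dual {A : OperatorClass.{u} 𝕜}
    (hA : A.IsBanachOperatorIdeal) :
    A.compactOperators.ContractivelyIncluded A.compactOperators.dual.dual := by
  intro E F _ _ _ _ _ _ T hT
  exact ⟨((compactOperators_covers_add hA hT one_pos).adj_adj hA).relativelyCompact,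
    size_le_of_forall_covers hA fun ε hε => (compactOperators_covers_add hA hT hε).adj_adj hA⟩

theorem RightAccessible.dual_dual_contractivelyIncluded {A : OperatorClass.{u} 𝕜}
    (hA : A.IsBanachOperatorIdeal) (hr : A.RightAccessible) :
    A.compactOperators.dual.dual.ContractivelyIncluded A.compactOperators := by
  intro E F _ _ _ _ _ _ T hT
  have hT' : A.compactOperators.Mem (adj (adj T)) := hT
  refine ⟨(hr.covers_of_adj_adj hA (compactOperators_covers_add hA hT' one_pos)
    (δ := 1 / 2) (by norm_num) (by norm_num)).relativelyCompact, ?_⟩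
  change _ ≤ A.compactOperators.nrm (adj (adj T))
  set c := A.compactOperators.nrm (adj (adj T)) with hc
  -- The same `δ` serves as the slack in the infimum and as the gluing parameter.
  have hlim : Tendsto (fun δ : ℝ => (c + δ) * (1 - δ)⁻¹ ^ 2) (𝓝[>] 0)
      (𝓝 ((c + 0) * (1 - 0)⁻¹ ^ 2)) := by
    refine Tendsto.mono_left ?_ nhdsWithin_le_nhds
    refine ContinuousAt.tendsto (f := fun δ : ℝ => (c + δ) * (1 - δ)⁻¹ ^ 2) ?_
    fun_prop (disch := norm_num)
  rw [add_zero, sub_zero, inv_one, one_pow, mul_one] at hlim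
  refine ge_of_tendsto hlim ?_
  filter_upwards [Ioo_mem_nhdsGT (zero_lt_one' ℝ)] with δ hδ
  exact (hr.covers_of_adj_adj hA (compactOperators_covers_add hA hT' hδ.1) hδ.1 hδ.2).size_le hA

end OperatorClass

end

theorem mainTheorem1 {𝕜 : Type} [RCLike 𝕜] (A : OperatorClass.{u} 𝕜)
    (hA : A.IsBanachOperatorIdeal) :
    A.compactOperators.ContractivelyIncluded A.compactOperators.dual.dual ∧
    (A.RightAccessible →
      A.compactOperators.IsometricallyEqual A.compactOperators.dual.dual ∧
      A.compactOperators.IsDualIdeal) := by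
  have h1 := OperatorClass.compactOperators_contractivelyIncluded_dual_dual hA
  refine ⟨h1, fun hr => ?_⟩
  have h2 := hr.dual_dual_contractivelyIncluded hA
  have h3 : A.compactOperators.IsometricallyEqual A.compactOperators.dual.dual := by
    intro E F _ _ _ _ _ _ T
    exact ⟨⟨fun h => (h1 T h).1, fun h => (h2 T h).1⟩,
      fun h => le_antisymm (h2 T (h1 T h).1).2 (h1 T h).2⟩
  exact ⟨h3, A.compactOperators.dual, hA.compactOperators.dual, h3⟩
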